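/- Let $\mathfrak g$ be the Lie algebra of a compact Lie group, with an invariant inner product $\langle\cdot,\cdot\rangle$ (only the structure of a finite-dimensional real inner product space is used). Let $\Omega\subset\mathbb R^n$ be a bounded Lipschitz domain, and let $\mathcal T_h$ be a triangulation of $\overline\Omega$, i.e. the set of $n$-dimensional simplices $K$ of a finite simplicial complex in $\mathbb R^n$ with underlying space $\overline\Omega$. Exterior derivatives $d$ of $\mathfrak g$-valued forms are taken in the sense of distributions, $\langle(\alpha\otimes\xi)\wedge(\beta\otimes\eta)\rangle=\langle\xi,\eta\rangle\,\alpha\wedge\beta$, and $L^p\Lambda^k$ is the space of $\mathfrak g$-valued $k$-forms with $L^p$ coefficients (zero if $k<0$). Put \begin{align*} V^0&=\{\phi\in L^\infty\Lambda^0(\overline\Omega): d\phi\in L^4\Lambda^1(\overline\Omega)\}, & V^1&=\{A\in L^4\Lambda^1(\overline\Omega): dA\in L^2\Lambda^2(\overline\Omega)\},\\ DV^0&=\{\phi\in L^\infty\Lambda^0(\overline\Omega): d(\phi|_K)\in L^4\Lambda^1(K)\ \forall K\in\mathcal T_h\}, & DV^1&=\{A\in L^4\Lambda^1(\overline\Omega):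 d(A|_K)\in L^2\Lambda^2(K)\ \forall K\in\mathcal T_h\},\\ \widehat V^{n-1}&=\{\widehat D\in L^{4/3}\Lambda^{n-1}(\overline\Omega): d\widehat D\in L^1\Lambda^n(\overline\Omega)\}, & \widehat V^{n-2}&=\{\widehat H\in L^2\Lambda^{n-2}(\overline\Omega): d\widehat H\in L^{4/3}\Lambda^{n-1}(\overline\Omega)\}. \end{align*} For a $k$-form $u$ and an $(n-k-1)$-form $\lambda$ on $M$ ($M=K$ or $M=\overline\Omega$) for which the right-hand side makes sense, put $$\int_{\partial M}\langle u\wedge\lambda\rangle:=\int_M\bigl(\langle du\wedge\lambda\rangle+(-1)^k\langle u\wedge d\lambda\rangle\bigr).$$ Let $\mathring V^k$ ($k=0,1$) be the set of $u\in V^k$ whose tangential trace on $\partial\Omega$ vanishes, that is, $\int_{\partial\overline\Omega}\langle u\wedge\lambda\rangle=0$ for all $(n-k-1)$-forms $\lambda$ that are smooth up to the boundary (restrictions to $\overline\Omega$ of $C^\infty$ forms on $\mathbb R^n$). Then: (i) for every $\phi\in DV^0$, we have $\phi\in\mathring V^0$ if and only if $\sum_{K\in\mathcal T_h}\int_{\partial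 K}\langle\phi,\widehat D\rangle=0$ for all $\widehat D\in\widehat V^{n-1}$; (ii) for every $A\in DV^1$, we have $A\in\mathring V^1$ if and only if $\sum_{K\in\mathcal T_h}\int_{\partial K}\langle A\wedge\widehat H\rangle=0$ for all $\widehat H\in\widehat V^{n-2}$. -/

import Mathlib

open MeasureTheory

noncomputable section

namespace YangMills

/-- Euclidean space `ℝⁿ` with its standard norm and Lebesgue measure. -/
abbrev Space (n : ℕ) : Type := EuclideanSpace ℝ (Fin n)

/-- Alternating `k`-covectors on `ℝⁿ` with values in `𝔤`, i.e. `⋀ᵏ(ℝⁿ)* ⊗ 𝔤`. -/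
abbrev Covector (n k : ℕ) (𝔤 : Type*) [NormedAddCommGroup 𝔤] [InnerProductSpace ℝ 𝔤] : Type _ :=
  Space n [⋀^Fin k]→L[ℝ] 𝔤

/-- `𝔤`-valued `k`-forms. Everything below only depends on a form up to equality almost everywhere
on the open set under consideration. -/
abbrev Form (n k : ℕ) (𝔤 : Type*) [NormedAddCommGroup 𝔤] [InnerProductSpace ℝ 𝔤] : Type _ :=
  Space n → Covector n k 𝔤

/-- A bounded Lipschitz domain: a bounded connected open set that near each of its boundary points
is, in suitable Cartesian coordinates, the set of points above the graph of a Lipschitz function.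
Here `ν` is the unit vector of the vertical axis and `γ` is a function on the hyperplane `ν^⊥`. -/
structure IsLipschitzDomain {n : ℕ} (Ω : Set (Space n)) : Prop where
  isOpen : IsOpen Ω
  isConnected : IsConnected Ω
  isBounded : Bornology.IsBounded Ω
  lipschitz_boundary : ∀ x ∈ frontier Ω, ∃ (ν : Space n) (r : ℝ) (L : NNReal)
    (γ : (ℝ ∙ ν)ᗮ → ℝ), ‖ν‖ = 1 ∧ 0 < r ∧ LipschitzWith L γ ∧
      ∀ y ∈ Metric.ball x r, y ∈ Ω ↔ γ ((ℝ ∙ ν)ᗮ.orthogonalProjectionOnto y) < inner ℝ ν y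

/-- A triangulation of `closure Ω`: a finite (geometric) simplicial complex whose underlying space
is `closure Ω`. -/
structure Triangulation {n : ℕ} (Ω : Set (Space n))
    extends Geometry.SimplicialComplex ℝ (Space n) where
  finite_faces : faces.Finite
  space_eq : toSimplicialComplex.space = closure Ω

/-- The (vertex sets of the) elements of the triangulation, i.e. of its `n`-dimensional simplices.
-/
def Triangulation.cells {n : ℕ} {Ω : Set (Space n)} (T : Triangulation Ω) :
    Finset (Finset (Space n)) :=
  T.finite_faces.toFinset.filter (fun s => s.card = n + 1)

/-- The interior of the closed simplex `K` with vertex set `s`. (The boundary of `K` is a null set,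
so that integrating over `K` or over its interior is the same, and so are `L^p(K)` and `L^p` of the
interior.) -/
def cellInterior {n : ℕ} (s : Finset (Space n)) : Set (Space n) :=
  interior (convexHull ℝ (s : Set (Space n)))

section Forms

variable {n k l m : ℕ} {𝔤 : Type*} [NormedAddCommGroup 𝔤] [InnerProductSpace ℝ 𝔤]

/-- The real-valued exterior product `⟨u ∧ v⟩`, with
`⟨(α ⊗ ξ) ∧ (β ⊗ η)⟩ = ⟨ξ, η⟩ (α ∧ β)`: the exterior product with values in `𝔤 ⊗ 𝔤`
(sum over shuffles), followed by the inner product `𝔤 ⊗ 𝔤 → ℝ`. -/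
def wedgeInner (u : Covector n k 𝔤) (v : Covector n l 𝔤) : Space n [⋀^Fin (k + l)]→ₗ[ℝ] ℝ :=
  ((TensorProduct.lift (innerₗ 𝔤)).compAlternatingMap
    (u.toAlternatingMap.domCoprod v.toAlternatingMap)).domDomCongr finSumFinEquiv

/-- For `k + l = n`, the coefficient of the `n`-covector `⟨u ∧ v⟩` with respect to the standard
volume form `dx¹ ∧ ⋯ ∧ dxⁿ`. -/
def wedgeCoeff (h : k + l = n) (u : Covector n k 𝔤) (v : Covector n l 𝔤) : ℝ :=
  wedgeInner u v (fun i => EuclideanSpace.basisFun (Fin n) ℝ (Fin.cast h i))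

/-- `w = du` on the open set `U` in the sense of distributions: `u`, `w` are locally integrable on
`U` and `∫_U ⟨w ∧ η⟩ = (-1)^(k+1) ∫_U ⟨u ∧ dη⟩` for all smooth `(n-k-1)`-forms `η` with compact
support in `U`. (If `k ≥ n` there are no such `η`, and `w` is an alternating `(k+1)`-form on `ℝⁿ`,
hence zero.) -/
def IsWeakExtDeriv (U : Set (Space n)) (u : Form n k 𝔤) (w : Form n (k + 1) 𝔤) : Prop :=
  LocallyIntegrableOn u U volume ∧ LocallyIntegrableOn w U volume ∧
    ∀ (m : ℕ) (h : k + m + 1 = n) (η : Form n m 𝔤),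
      ContDiff ℝ (⊤ : ℕ∞) η → HasCompactSupport η → tsupport η ⊆ U →
      ∫ x in U, wedgeCoeff (by omega) (w x) (η x) =
        (-1) ^ (k + 1) * ∫ x in U, wedgeCoeff (by omega) (u x) (extDeriv η x)

open Classical in
/-- The distributional exterior derivative of `u` on `U` (unique almost everywhere on the open set
`U`, if there is one that is a locally integrable form; otherwise the value is irrelevant). -/
def weakExtDeriv (U : Set (Space n)) (u : Form n k 𝔤) : Form n (k + 1) 𝔤 :=
  if h : ∃ w, IsWeakExtDeriv U u w then h.choose else 0

/-- The forms `u` on `U` with `u ∈ L^p` and `du ∈ L^q`. -/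
def WSpace (n k : ℕ) (𝔤 : Type*) [NormedAddCommGroup 𝔤] [InnerProductSpace ℝ 𝔤]
    (U : Set (Space n)) (p q : ENNReal) : Set (Form n k 𝔤) :=
  {u | MemLp u p (volume.restrict U) ∧
    ∃ w, IsWeakExtDeriv U u w ∧ MemLp w q (volume.restrict U)}

/-- The boundary integral `∫_{∂U} ⟨u ∧ μ⟩`, for a `k`-form `u` and an `(n-k-1)`-form `μ` of
sufficient regularity, defined by
`∫_{∂U} ⟨u ∧ μ⟩ = ∫_U (⟨du ∧ μ⟩ + (-1)^k ⟨u ∧ dμ⟩)`. -/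
def boundaryIntegral (h : k + m + 1 = n) (U : Set (Space n)) (u : Form n k 𝔤) (μ : Form n m 𝔤) :
    ℝ :=
  ∫ x in U, (wedgeCoeff (by omega) (weakExtDeriv U u x) (μ x) +
    (-1) ^ k * wedgeCoeff (by omega) (u x) (weakExtDeriv U μ x))

/-- The tangential trace of `u` on `∂Ω` vanishes. The tangential trace of a form of low regularity
is the functional `μ ↦ ∫_{∂Ω} ⟨u ∧ μ⟩` on the `(n-k-1)`-forms `μ` that are smooth up to the
boundary of `Ω`. -/
def HasZeroTangentialTrace (Ω : Set (Space n)) (u : Form n k 𝔤) : Prop :=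
  ∀ (m : ℕ) (h : k + m + 1 = n) (μ : Form n m 𝔤), ContDiff ℝ (⊤ : ℕ∞) μ →
    boundaryIntegral h Ω u μ = 0

end Forms

section Spaces

variable {n : ℕ} (𝔤 : Type*) [NormedAddCommGroup 𝔤] [InnerProductSpace ℝ 𝔤] (Ω : Set (Space n))

/-- `V⁰`: `φ ∈ L^∞` with `dφ ∈ L⁴`. -/
def V0 : Set (Form n 0 𝔤) := WSpace n 0 𝔤 Ω ⊤ 4

/-- `V¹`: `A ∈ L⁴` with `dA ∈ L²`. -/
def V1 : Set (Form n 1 𝔤) := WSpace n 1 𝔤 Ω 4 2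

/-- The forms in `V⁰` with vanishing trace. -/
def V0Ring : Set (Form n 0 𝔤) := {φ | φ ∈ V0 𝔤 Ω ∧ HasZeroTangentialTrace Ω φ}

/-- The forms in `V¹` with vanishing tangential trace. -/
def V1Ring : Set (Form n 1 𝔤) := {A | A ∈ V1 𝔤 Ω ∧ HasZeroTangentialTrace Ω A}

variable {Ω}

/-- `DV⁰`: `φ ∈ L^∞(Ω)` with `d(φ|_K) ∈ L⁴(K)` for all elements `K`. -/
def DV0 (T : Triangulation Ω) : Set (Form n 0 𝔤) :=
  {φ | MemLp φ ⊤ (volume.restrict Ω) ∧ ∀ s ∈ T.cells, ∃ w, IsWeakExtDeriv (cellInterior s) φ w ∧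
    MemLp w 4 (volume.restrict (cellInterior s))}

/-- `DV¹`: `A ∈ L⁴(Ω)` with `d(A|_K) ∈ L²(K)` for all elements `K`. -/
def DV1 (T : Triangulation Ω) : Set (Form n 1 𝔤) :=
  {A | MemLp A 4 (volume.restrict Ω) ∧ ∀ s ∈ T.cells, ∃ w, IsWeakExtDeriv (cellInterior s) A w ∧
    MemLp w 2 (volume.restrict (cellInterior s))}

variable (Ω)

/-- The Lagrange multipliers `D̂ ∈ L^{4/3}` with `dD̂ ∈ L¹`; used in degree `m = n - 1`. -/
def VHatD (m : ℕ) : Set (Form n m 𝔤) := WSpace n m 𝔤 Ω (4 / 3) 1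

/-- The Lagrange multipliers `Ĥ ∈ L²` with `dĤ ∈ L^{4/3}`; used in degree `m = n - 2`. -/
def VHatH (m : ℕ) : Set (Form n m 𝔤) := WSpace n m 𝔤 Ω 2 (4 / 3)

end Spaces

end YangMills

end

/-! Write `u` for the broken form, `w` for the gluing of its cellwise derivatives and `v` for the
weak derivative of the multiplier `D`. The cell interiors are disjoint and fill Ω up to a null set,
so the element boundary terms add up to one integral, ∫_Ω ⟨w ∧ D⟩ + (-1)^k ⟨u ∧ v⟩
(`sum_boundaryIntegral_eq`). Both parts of the theorem ask when this integral vanishes for all `D`,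
and both are instances of `mem_WSpace_and_hasZeroTangentialTrace_iff`.

If it always vanishes, smooth `D` suffice: those with compact support in Ω show that `w` is the weak
derivative of `u` on all of Ω, and then those that are smooth up to the boundary show that the trace
is zero.

Conversely, zero trace gives the identity for smooth `D`, and Green's formula must be extended to
rough `D` (`FirstOrderDuality.integral_eq_zero`). By zero trace, the extension of `u` by zero has
the extension of `w` by zero as its weak derivative on ℝⁿ. After a partition of unity, the interior
cone property allows mollifying with a bump centred at a small inward vector tν; the mollified `u`
is then a test form with compact support in Ω and can be inserted in the definition of the weak
derivative of `D`. For p = ∞ the mollifications need not converge in norm. Fubini therefore turns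
the result into an average of G(z) = ∫ ⟨w, D(· + z)⟩ + ∫ ⟨u, v(· + z)⟩ over a small ball near 0.
Translations are continuous in the finite dual exponents p' and q', so G is continuous and G(0) = 0.

The only algebra needed is the adjointness of the symbols of the two exterior derivatives
(`wedgeCoeff_covWedge_left`) and the nondegeneracy of the wedge pairing, which makes weak
derivatives unique almost everywhere. The analysis is done for an abstract `FirstOrderDuality`, free
of degrees and signs. -/

namespace YangMills

/-! ### Multilinear algebra of the wedge pairing. -/

section Algebra

open Equiv

variable {n k l m : ℕ} {𝔤 : Type*} [NormedAddCommGroup 𝔤] [InnerProductSpace ℝ 𝔤]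

/-- The standard basis vectors of `ℝⁿ`. -/
noncomputable abbrev stdVec (i : Fin n) : Space n := EuclideanSpace.basisFun (Fin n) ℝ i

/-- The splitting of `Fin n` into its first `k` and its last `l` elements. -/
def splitFin (h : k + l = n) : Fin k ⊕ Fin l ≃ Fin n := finSumFinEquiv.trans (finCongr h)

@[simp] theorem splitFin_inl_val (h : k + l = n) (i : Fin k) :
    (splitFin h (Sum.inl i) : ℕ) = i := by simp [splitFin]

@[simp] theorem splitFin_inr_val (h : k + l = n) (i : Fin l) :
    (splitFin h (Sum.inr i) : ℕ) = k + i := by simp [splitFin]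

theorem sum_sign_mul_right {ι : Type*} [Fintype ι] [DecidableEq ι] (τ : Perm ι)
    (f : Perm ι → ℝ) :
    ∑ π : Perm ι, (Perm.sign π : ℝ) * f (π * τ) =
      (Perm.sign τ : ℝ) * ∑ π : Perm ι, (Perm.sign π : ℝ) * f π := by
  rw [Finset.mul_sum, ← Equiv.sum_comp (Equiv.mulRight τ) fun π => _ * (_ * f π)]
  refine Finset.sum_congr rfl fun π _ => ?_
  have h1 : ((Perm.sign τ : ℤˣ) : ℝ) * ((Perm.sign τ : ℤˣ) : ℝ) = 1 := by
    rcases Int.units_eq_one_or (Perm.sign τ) with h | h <;> simp [h]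
  simp only [Equiv.coe_mulRight, Perm.sign_mul, Units.val_mul, Int.cast_mul]
  linear_combination -(Perm.sign π : ℝ) * f (π * τ) * h1

/-- The exterior product as a normalized sum over all permutations. -/
theorem factorial_mul_wedgeCoeff (h : k + l = n) (u : Covector n k 𝔤) (v : Covector n l 𝔤) :
    ((k.factorial * l.factorial : ℕ) : ℝ) * wedgeCoeff h u v =
      ∑ π : Perm (Fin n), (Perm.sign π : ℝ) *
        inner ℝ (u fun i => stdVec (π (splitFin h (Sum.inl i))))
          (v fun j => stdVec (π (splitFin h (Sum.inr j)))) := by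
  -- Alternating over all permutations counts each shuffle k! l! times.
  have key := MultilinearMap.domCoprod_alternization_eq u.toAlternatingMap v.toAlternatingMap
  have key2 := congrArg (fun F => (TensorProduct.lift (innerₗ 𝔤))
    (F fun i => stdVec (splitFin h i))) key
  simp only [Fintype.card_fin, AlternatingMap.smul_apply, map_nsmul, nsmul_eq_mul] at key2
  have h1 : wedgeCoeff h u v = (TensorProduct.lift (innerₗ 𝔤))
    ((u.toAlternatingMap.domCoprod v.toAlternatingMap) fun i => stdVec (splitFin h i)) := rfl
  rw [h1, ← key2, MultilinearMap.alternatization_apply, map_sum]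
  rw [← (splitFin h).permCongr.sum_comp]
  refine Finset.sum_congr rfl fun σ _ => ?_
  rw [Perm.sign_permCongr, Units.smul_def, map_zsmul, zsmul_eq_mul]
  simp [MultilinearMap.domDomCongr_apply]

theorem sign_mul_sign_cast {ι : Type*} [Fintype ι] [DecidableEq ι] (τ : Perm ι) :
    ((Perm.sign τ : ℤˣ) : ℝ) * ((Perm.sign τ : ℤˣ) : ℝ) = 1 := by
  rcases Int.units_eq_one_or (Perm.sign τ) with h | h <;> simp [h]

/-- The cyclic shift by `l` of `Fin (k + l)` has sign `(-1) ^ (k * l)`. -/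
theorem exists_perm_shift (h : k + l = n) :
    ∃ τ : Perm (Fin n), ((Perm.sign τ : ℤˣ) : ℝ) = (-1) ^ (k * l) ∧
      ∀ x : Fin n, (τ x : ℕ) = (x + l) % n := by
  obtain rfl | hn := Nat.eq_zero_or_pos n
  · obtain ⟨rfl, rfl⟩ : k = 0 ∧ l = 0 := by omega
    exact ⟨1, by simp, fun x => x.elim0⟩
  obtain ⟨N, rfl⟩ : ∃ N, n = N + 1 := ⟨n - 1, by omega⟩
  have hτv : ∀ (j : ℕ) (x : Fin (N + 1)),
      (((finRotate (N + 1) ^ j) x : Fin (N + 1)) : ℕ) = (x + j) % (N + 1) := by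
    intro j
    induction j with
    | zero => intro x; simp [Nat.mod_eq_of_lt x.2]
    | succ j ih =>
      intro x
      rw [pow_succ', Perm.mul_apply, finRotate_apply, Fin.val_add, ih, Fin.val_one',
        ← Nat.add_mod, add_assoc]
  refine ⟨finRotate (N + 1) ^ l, ?_, hτv l⟩
  rw [map_pow, sign_finRotate]
  push_cast
  rw [← pow_mul]
  obtain rfl | hl := Nat.eq_zero_or_pos l
  · simp
  · obtain ⟨l, rfl⟩ : ∃ l', l = l' + 1 := ⟨l - 1, by omega⟩
    obtain rfl : N = k + l := by omega
    -- The second block now has size l + 1, and the exponent (k + l)(l + 1) differs from k(l + 1) by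
    -- the even number l(l + 1).
    have : Even (l * (l + 1)) := Nat.even_mul_succ_self l
    rw [add_mul, pow_add, this.neg_one_pow, mul_one]

/-- In the permutation sum, composing with the cyclic shift by l exchanges the two blocks of indices
and costs the sign of the shift. -/
theorem wedgeCoeff_comm (h : k + l = n) (h' : l + k = n) (u : Covector n k 𝔤)
    (v : Covector n l 𝔤) : wedgeCoeff h u v = (-1) ^ (k * l) * wedgeCoeff h' v u := by
  have hpos : ((k.factorial * l.factorial : ℕ) : ℝ) ≠ 0 := by positivity
  apply mul_left_cancel₀ hpos
  rw [mul_left_comm, factorial_mul_wedgeCoeff, mul_comm k.factorial, factorial_mul_wedgeCoeff]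
  obtain ⟨τ, hsgn, hτv⟩ := exists_perm_shift h
  have h1 : ∀ i, τ (splitFin h (Sum.inl i)) = splitFin h' (Sum.inr i) := fun i => by
    apply Fin.ext
    rw [hτv, splitFin_inl_val, splitFin_inr_val, Nat.mod_eq_of_lt (by omega), add_comm]
  have h2 : ∀ j, τ (splitFin h (Sum.inr j)) = splitFin h' (Sum.inl j) := fun j => by
    apply Fin.ext
    rw [hτv, splitFin_inl_val, splitFin_inr_val, show k + (j : ℕ) + l = j + n by omega,
      Nat.add_mod_right, Nat.mod_eq_of_lt (by omega)]
  have h3 := sum_sign_mul_right τ fun π => inner ℝ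
    (u fun i => stdVec (π (splitFin h (Sum.inl i)))) (v fun j => stdVec (π (splitFin h (Sum.inr j))))
  simp only [Perm.mul_apply, h1, h2] at h3
  simp_rw [real_inner_comm (u _) (v _)] at h3 ⊢
  rw [h3, ← hsgn, ← mul_assoc, sign_mul_sign_cast, one_mul]

/-- The exterior product of a (real-valued) linear form with a covector. -/
noncomputable def covWedge (ℓ : Space n →L[ℝ] ℝ) (u : Covector n k 𝔤) : Covector n (k + 1) 𝔤 :=
  ContinuousAlternatingMap.alternatizeUncurryFin (ℓ.smulRight u)

theorem covWedge_apply (ℓ : Space n →L[ℝ] ℝ) (u : Covector n k 𝔤) (v : Fin (k + 1) → Space n) :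
    covWedge ℓ u v = ∑ i : Fin (k + 1), (-1) ^ (i : ℕ) • ℓ (v i) • u (i.removeNth v) := by
  simp [covWedge, ContinuousAlternatingMap.alternatizeUncurryFin_apply]

/-- The k + 1 terms of the alternatization contribute equally: the cycle that brings slot i to the
front has sign (-1)^i, which cancels the sign of the term. The factor k + 1 so gained turns (k + 1)!
into k!. -/
theorem factorial_mul_wedgeCoeff_covWedge (h : k + 1 + m = n) (ℓ : Space n →L[ℝ] ℝ)
    (u : Covector n k 𝔤) (v : Covector n m 𝔤) :
    ((k.factorial * m.factorial : ℕ) : ℝ) * wedgeCoeff h (covWedge ℓ u) v =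
      ∑ π : Perm (Fin n), (Perm.sign π : ℝ) *
        (ℓ (stdVec (π (splitFin h (Sum.inl 0)))) *
        inner ℝ (u fun i => stdVec (π (splitFin h (Sum.inl i.succ))))
          (v fun j => stdVec (π (splitFin h (Sum.inr j))))) := by
  have hpos : ((k + 1 : ℕ) : ℝ) ≠ 0 := by positivity
  apply mul_left_cancel₀ hpos
  have h1 := factorial_mul_wedgeCoeff h (covWedge ℓ u) v
  rw [Nat.factorial_succ, mul_assoc, Nat.cast_mul, mul_assoc] at h1
  rw [h1]
  simp only [covWedge_apply, sum_inner, Finset.mul_sum]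
  rw [Finset.sum_comm]
  have key : ∀ i : Fin (k + 1), ∑ π : Perm (Fin n), (Perm.sign π : ℝ) *
      inner ℝ ((-1 : ℤ) ^ (i : ℕ) • ℓ (stdVec (π (splitFin h (Sum.inl i)))) •
        u (i.removeNth fun i => stdVec (π (splitFin h (Sum.inl i)))))
          (v fun j => stdVec (π (splitFin h (Sum.inr j)))) =
      ∑ π : Perm (Fin n), (Perm.sign π : ℝ) *
        (ℓ (stdVec (π (splitFin h (Sum.inl 0)))) *
        inner ℝ (u fun i => stdVec (π (splitFin h (Sum.inl i.succ))))
          (v fun j => stdVec (π (splitFin h (Sum.inr j))))) := by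
    intro i
    set τ : Perm (Fin n) := (splitFin h).permCongr (Perm.sumCongr i.cycleRange.symm 1) with hτ
    have hs : ((Perm.sign τ : ℤˣ) : ℝ) = (-1) ^ (i : ℕ) := by
      rw [hτ, Perm.sign_permCongr, Perm.sign_sumCongr]
      simp
    have h3 := sum_sign_mul_right τ fun π => (ℓ (stdVec (π (splitFin h (Sum.inl 0)))) *
        inner ℝ (u fun i => stdVec (π (splitFin h (Sum.inl i.succ))))
          (v fun j => stdVec (π (splitFin h (Sum.inr j)))))
    simp only [hτ, Perm.mul_apply, Equiv.permCongr_apply, Equiv.symm_apply_apply,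
      Perm.sumCongr_apply, Sum.map_inl, Sum.map_inr, Perm.one_apply, Fin.cycleRange_symm_zero,
      Fin.cycleRange_symm_succ] at h3
    rw [← hτ, hs] at h3
    have h4 : ((-1 : ℝ) ^ (i : ℕ)) * (-1) ^ (i : ℕ) = 1 := by
      rw [← mul_pow]; simp
    apply mul_left_cancel₀ (left_ne_zero_of_mul_eq_one h4)
    rw [← h3, Finset.mul_sum]
    refine Finset.sum_congr rfl fun π _ => ?_
    rw [← Int.cast_smul_eq_zsmul ℝ, inner_smul_left, inner_smul_left]
    simp only [Int.cast_pow, Int.cast_neg, Int.cast_one, map_pow, map_neg, map_one,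
      RCLike.conj_to_real]
    have : (i.removeNth fun i => stdVec (π (splitFin h (Sum.inl i)))) =
      fun j => stdVec (π (splitFin h (Sum.inl (i.succAbove j)))) := rfl
    rw [this]
    linear_combination (Perm.sign π : ℝ) * (ℓ (stdVec (π (splitFin h (Sum.inl i)))) *
        inner ℝ (u fun j => stdVec (π (splitFin h (Sum.inl (i.succAbove j)))))
          (v fun j => stdVec (π (splitFin h (Sum.inr j))))) * h4
  rw [Finset.sum_congr rfl fun i _ => key i]
  simp [Finset.mul_sum]

/-- Once the right-hand pairing is commuted, both sides are permutation sums with ℓ in front, which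
differ by a reordering of known sign. This is the pointwise identity behind every integration by
parts below. -/
theorem wedgeCoeff_covWedge_left (h : k + 1 + m = n) (h' : k + (m + 1) = n) (ℓ : Space n →L[ℝ] ℝ)
    (u : Covector n k 𝔤) (v : Covector n m 𝔤) :
    wedgeCoeff h (covWedge ℓ u) v = (-1) ^ k * wedgeCoeff h' u (covWedge ℓ v) := by
  have h'' : m + 1 + k = n := by omega
  have hpos : ((k.factorial * m.factorial : ℕ) : ℝ) ≠ 0 := by positivity
  apply mul_left_cancel₀ hpos
  rw [factorial_mul_wedgeCoeff_covWedge, wedgeCoeff_comm h' h'', ← mul_assoc ((-1) ^ k),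
    mul_left_comm, mul_comm k.factorial, factorial_mul_wedgeCoeff_covWedge]
  obtain ⟨ρ, hsgn, hρ⟩ := exists_perm_shift h'
  -- `c` is the slot of ℓ in the order u, ℓ, v. The inverse of `c.cycleRange` passes from the slots
  -- of ℓ, u, v to those of u, ℓ, v, and ρ from there to those of ℓ, v, u.
  set c : Fin n := ⟨k, by omega⟩ with hc
  have hsgn2 : ((Perm.sign c.cycleRange : ℤˣ) : ℝ) = (-1) ^ k := by
    rw [Fin.sign_cycleRange]; simp [hc]
  have e0 : (c.cycleRange).symm (splitFin h (Sum.inl 0)) = c := by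
    rw [Equiv.symm_apply_eq]
    apply Fin.ext
    rw [Fin.coe_cycleRange_of_le le_rfl]
    simp
  have e1 : ∀ i : Fin k, (c.cycleRange).symm (splitFin h (Sum.inl i.succ)) =
      ⟨i, by omega⟩ := fun i => by
    rw [Equiv.symm_apply_eq]
    apply Fin.ext
    rw [Fin.coe_cycleRange_of_lt (by rw [Fin.lt_def]; exact i.2)]
    simp
  have e2 : ∀ j : Fin m, (c.cycleRange).symm (splitFin h (Sum.inr j)) =
      splitFin h (Sum.inr j) := fun j => by
    rw [Equiv.symm_apply_eq, Fin.cycleRange_of_gt]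
    rw [Fin.lt_def, splitFin_inr_val, hc]
    dsimp only
    omega
  have f0 : ρ c = splitFin h'' (Sum.inl 0) := by
    apply Fin.ext
    rw [hρ, splitFin_inl_val, h', Nat.mod_self]
    rfl
  have f1 : ∀ i : Fin k, ρ ⟨i, by omega⟩ = splitFin h'' (Sum.inr i) := fun i => by
    apply Fin.ext
    rw [hρ, splitFin_inr_val, Nat.mod_eq_of_lt (by dsimp only; omega), add_comm]
  have f2 : ∀ j : Fin m, ρ (splitFin h (Sum.inr j)) = splitFin h'' (Sum.inl j.succ) := fun j => by
    apply Fin.ext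
    rw [hρ, splitFin_inr_val, splitFin_inl_val, Fin.val_succ,
      show k + 1 + (j : ℕ) + (m + 1) = j + 1 + n by omega, Nat.add_mod_right,
      Nat.mod_eq_of_lt (by omega)]
  have h3 := sum_sign_mul_right (ρ * c.cycleRange⁻¹) fun π =>
      ℓ (stdVec (π (splitFin h (Sum.inl 0)))) *
        inner ℝ (u fun i => stdVec (π (splitFin h (Sum.inl i.succ))))
          (v fun j => stdVec (π (splitFin h (Sum.inr j))))
  simp only [Perm.mul_apply, Perm.inv_def, e0, e1, e2, f0, f1, f2] at h3
  simp_rw [real_inner_comm (u _) (v _)] at h3 ⊢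
  rw [h3, Perm.sign_mul, Perm.sign_symm, Units.val_mul, Int.cast_mul, hsgn, hsgn2,
    mul_comm ((-1 : ℝ) ^ k), ← mul_assoc, ← hsgn, ← hsgn2, mul_mul_mul_comm, sign_mul_sign_cast,
    sign_mul_sign_cast, mul_one, one_mul]

theorem wedgeCoeff_zero_right (h : k + 0 = n) (u : Covector n k 𝔤) (v : Covector n 0 𝔤) :
    wedgeCoeff h u v = inner ℝ (u fun i => stdVec (Fin.cast h i)) (v 0) := by
  have hk : k = n := h
  subst hk
  have hpos : ((k.factorial * Nat.factorial 0 : ℕ) : ℝ) ≠ 0 := by positivity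
  apply mul_left_cancel₀ hpos
  rw [factorial_mul_wedgeCoeff]
  have h1 : ∀ π : Perm (Fin k), (Perm.sign π : ℝ) *
      inner ℝ (u fun i => stdVec (π (splitFin h (Sum.inl i))))
        (v fun j => stdVec (π (splitFin h (Sum.inr j)))) =
      inner ℝ (u fun i => stdVec i) (v 0) := by
    intro π
    have h2 : (u fun i => stdVec (π (splitFin h (Sum.inl i)))) =
        Perm.sign π • u fun i => stdVec i := by
      refine Eq.trans ?_ (u.toAlternatingMap.map_perm (fun i => stdVec i) π)
      congr 1
    rw [h2, Units.smul_def, ← Int.cast_smul_eq_zsmul ℝ, inner_smul_left,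
      Subsingleton.elim (fun j => stdVec (π (splitFin h (Sum.inr j)))) 0]
    simp [← mul_assoc, sign_mul_sign_cast]
  rw [Finset.sum_congr rfl fun π _ => h1 π]
  simp [Fintype.card_perm]

/-- The exterior product is a nondegenerate pairing. -/
theorem eq_zero_of_wedgeCoeff_eq_zero (h : k + l = n) (u : Covector n k 𝔤)
    (hu : ∀ v : Covector n l 𝔤, wedgeCoeff h u v = 0) : u = 0 := by
  induction l generalizing k with
  | zero =>
    subst h
    have h1 := hu (ContinuousAlternatingMap.constOfIsEmpty ℝ (Space k) (Fin 0)
      (u fun i => stdVec i))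
    rw [wedgeCoeff_zero_right] at h1
    have h2 : (u fun i => stdVec i) = 0 := by simpa using h1
    apply ContinuousAlternatingMap.toAlternatingMap_injective
    refine Module.Basis.ext_alternating (EuclideanSpace.basisFun (Fin k) ℝ).toBasis fun v hv => ?_
    obtain ⟨π, rfl⟩ : ∃ π : Perm (Fin k), v = π :=
      ⟨Equiv.ofBijective v (Finite.injective_iff_bijective.1 hv), rfl⟩
    have h3 : (u fun i => stdVec (π i)) = Perm.sign π • u fun i => stdVec i := by
      refine Eq.trans ?_ (u.toAlternatingMap.map_perm (fun i => stdVec i) π)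
      congr 1
    rw [h2, smul_zero] at h3
    simpa using h3
  | succ l ih =>
    -- Moving ℓ across the pairing raises the degree of `u`, where the induction hypothesis applies.
    have h1 : ∀ ℓ : Space n →L[ℝ] ℝ, covWedge ℓ u = 0 := fun ℓ => by
      refine ih (by omega) _ fun v => ?_
      rw [wedgeCoeff_covWedge_left _ h, hu, mul_zero]
    apply ContinuousAlternatingMap.toAlternatingMap_injective
    refine Module.Basis.ext_alternating (EuclideanSpace.basisFun (Fin n) ℝ).toBasis fun v hv => ?_
    -- Since k < n, some index i is missing from v; evaluating dxⁱ ∧ u on e_i followed by the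
    -- vectors of v returns u on v.
    obtain ⟨i, hi⟩ : ∃ i : Fin n, i ∉ Set.range v := by
      by_contra! hcon
      have := Fintype.card_le_of_surjective v hcon
      simp at this
      omega
    have h2 := congrArg (fun w => w (Fin.cons (stdVec i) fun j => stdVec (v j)))
      (h1 (EuclideanSpace.proj i))
    simp only [covWedge_apply, Fin.sum_univ_succ] at h2
    have h3 : ∀ j, i ≠ v j := fun j hj => hi ⟨j, hj.symm⟩
    simpa [h3] using h2

end Algebra
end YangMills

namespace YangMills

/-! ### Lipschitz domains and triangulations. -/

section Geometry

open Metric Set Filter Topology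

variable {n : ℕ} {Ω : Set (Space n)}

/-- In the local coordinates of a Lipschitz domain, the closure of the domain lies above the graph
and its boundary lies on the graph. -/
theorem graph_of_lipschitz_chart (hΩ : IsOpen Ω) {x ν : Space n} {r : ℝ} {γ : (ℝ ∙ ν)ᗮ → ℝ}
    (hγ : Continuous γ)
    (h : ∀ y ∈ ball x r, y ∈ Ω ↔ γ ((ℝ ∙ ν)ᗮ.orthogonalProjectionOnto y) < inner ℝ ν y) :
    (∀ y ∈ ball x r, y ∈ closure Ω → γ ((ℝ ∙ ν)ᗮ.orthogonalProjectionOnto y) ≤ inner ℝ ν y) ∧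
    ∀ y ∈ ball x r, y ∈ frontier Ω → γ ((ℝ ∙ ν)ᗮ.orthogonalProjectionOnto y) = inner ℝ ν y := by
  have h1 : ∀ y ∈ ball x r, y ∈ closure Ω →
      γ ((ℝ ∙ ν)ᗮ.orthogonalProjectionOnto y) ≤ inner ℝ ν y := by
    intro y hy hyc
    by_contra! hlt
    have hopen : IsOpen (ball x r ∩ {z | inner ℝ ν z < γ ((ℝ ∙ ν)ᗮ.orthogonalProjectionOnto z)}) :=
      isOpen_ball.inter (isOpen_lt (by fun_prop) (by fun_prop))
    obtain ⟨z, ⟨hz1, hz2⟩, hz3⟩ := mem_closure_iff.1 hyc _ hopen ⟨hy, hlt⟩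
    exact absurd ((h z hz1).1 hz3) (not_lt.2 (le_of_lt hz2))
  refine ⟨h1, fun y hy hyf => le_antisymm (h1 y hy hyf.1) ?_⟩
  have : y ∉ Ω := fun h => hyf.2 (by rwa [hΩ.interior_eq])
  rw [h y hy, not_lt] at this
  exact this

theorem orthogonalProjection_add_smul_self (ν y : Space n) (t : ℝ) :
    (ℝ ∙ ν)ᗮ.orthogonalProjectionOnto (y + t • ν) = (ℝ ∙ ν)ᗮ.orthogonalProjectionOnto y := by
  rw [map_add, map_smul,
    Submodule.orthogonalProjectionOnto_orthogonal_apply_eq_zero (Submodule.mem_span_singleton_self ν)]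
  simp

/-- A Lipschitz domain lies on one side of its boundary: from a boundary point interior to the
closure, a small step along -ν would stay in the closure and yet fall below the graph. This places
cell interiors in Ω and not merely in its closure. -/
theorem IsLipschitzDomain.interior_closure (hΩ : IsLipschitzDomain Ω) :
    interior (closure Ω) = Ω := by
  refine Subset.antisymm (fun x hx => ?_) (interior_maximal subset_closure hΩ.isOpen)
  by_contra hxΩ
  have hxf : x ∈ frontier Ω := ⟨interior_subset hx, by rwa [hΩ.isOpen.interior_eq]⟩
  obtain ⟨ν, r, L, γ, hν, hr, hL, h⟩ := hΩ.lipschitz_boundary x hxf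
  obtain ⟨h1, h2⟩ := graph_of_lipschitz_chart hΩ.isOpen hL.continuous h
  have hlim : Tendsto (fun t : ℝ => x + t • ν) (𝓝[<] 0) (𝓝 x) := by
    have : Tendsto (fun t : ℝ => x + t • ν) (𝓝 0) (𝓝 (x + (0 : ℝ) • ν)) :=
      Continuous.tendsto (by fun_prop) _
    rw [zero_smul, add_zero] at this
    exact this.mono_left nhdsWithin_le_nhds
  have e1 := hlim.eventually (isOpen_interior.mem_nhds hx)
  have e2 := hlim.eventually (isOpen_ball.mem_nhds (mem_ball_self hr))
  obtain ⟨t, ⟨ht1, ht2⟩, ht3⟩ := ((e1.and e2).and self_mem_nhdsWithin).exists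
  have h3 := h1 _ ht2 (interior_subset ht1)
  rw [orthogonalProjection_add_smul_self, h2 x (mem_ball_self hr) hxf, inner_add_right,
    inner_smul_right, real_inner_self_eq_norm_sq, hν] at h3
  have ht4 : t < 0 := ht3
  linarith

/-- Near each point of its closure, a Lipschitz domain satisfies a uniform interior cone
condition. -/
theorem IsLipschitzDomain.exists_cone (hΩ : IsLipschitzDomain Ω) {x : Space n}
    (hx : x ∈ closure Ω) :
    ∃ (ν : Space n) (r δ t₀ : ℝ), 0 < r ∧ 0 < δ ∧ 0 < t₀ ∧ ∀ t, 0 < t → t < t₀ →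
      ∀ y ∈ closure Ω ∩ ball x r, closedBall (y + t • ν) (δ * t) ⊆ Ω := by
  by_cases hxΩ : x ∈ Ω
  · obtain ⟨R, hR, hball⟩ := Metric.isOpen_iff.1 hΩ.isOpen x hxΩ
    -- At an interior point no shift is needed, so ν = 0.
    refine ⟨0, R / 2, 1, R / 2, by positivity, one_pos, by positivity, fun t ht ht0 y hy z hz => ?_⟩
    apply hball
    simp only [smul_zero, add_zero, one_mul, mem_closedBall] at hz
    have := hy.2
    rw [mem_ball] at this ⊢
    linarith [dist_triangle z y x]
  · have hxf : x ∈ frontier Ω := ⟨hx, by rwa [hΩ.isOpen.interior_eq]⟩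
    obtain ⟨ν, r, L, γ, hν, hr, hL, h⟩ := hΩ.lipschitz_boundary x hxf
    obtain ⟨h1, -⟩ := graph_of_lipschitz_chart hΩ.isOpen hL.continuous h
    have hL0 : (0 : ℝ) ≤ L := L.2
    -- A perturbation w with ‖w‖ ≤ δt changes the height above the graph by at most (L + 1)δt, which
    -- for δ = 1/(L + 2) is less than the gain t. The radii r/2 and r/4 keep the perturbed point in
    -- the chart, since it moves by at most 2t.
    refine ⟨ν, r / 2, 1 / (L + 2), r / 4, by positivity, by positivity, by positivity,
      fun t ht ht0 y hy z hz => ?_⟩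
    set δ : ℝ := 1 / (L + 2) with hδ
    have hδ1 : δ * (L + 2) = 1 := by rw [hδ]; field_simp
    have hδ0 : 0 < δ := by positivity
    have hyr : dist y x < r / 2 := hy.2
    set w : Space n := z - (y + t • ν) with hw
    have hwn : ‖w‖ ≤ δ * t := by rwa [mem_closedBall, dist_eq_norm] at hz
    have hz' : z = (y + w) + t • ν := by rw [hw]; abel
    have hδle : δ * t ≤ t := by nlinarith
    have hzr : z ∈ ball x r := by
      rw [mem_ball]
      have : dist z y ≤ 2 * t := by
        rw [dist_eq_norm, hz', show y + w + t • ν - y = w + t • ν by abel]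
        refine (norm_add_le _ _).trans ?_
        rw [norm_smul, hν, Real.norm_of_nonneg ht.le]
        linarith
      linarith [dist_triangle z y x]
    rw [h z hzr, hz', orthogonalProjection_add_smul_self, inner_add_right, inner_smul_right,
      real_inner_self_eq_norm_sq, hν, inner_add_right]
    have h2 := h1 y (by rw [mem_ball]; linarith) hy.1
    have h3 : γ ((ℝ ∙ ν)ᗮ.orthogonalProjectionOnto (y + w)) ≤
        γ ((ℝ ∙ ν)ᗮ.orthogonalProjectionOnto y) + L * ‖w‖ := by
      have h4 := hL.dist_le_mul ((ℝ ∙ ν)ᗮ.orthogonalProjectionOnto (y + w))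
        ((ℝ ∙ ν)ᗮ.orthogonalProjectionOnto y)
      rw [Real.dist_eq, dist_eq_norm, ← map_sub, add_sub_cancel_left] at h4
      have h5 := (ℝ ∙ ν)ᗮ.norm_orthogonalProjectionOnto_apply_le w
      have h6 := mul_le_mul_of_nonneg_left h5 hL0
      linarith [le_abs_self (γ ((ℝ ∙ ν)ᗮ.orthogonalProjectionOnto (y + w)) -
        γ ((ℝ ∙ ν)ᗮ.orthogonalProjectionOnto y))]
    have h7 : -‖w‖ ≤ inner ℝ ν w := by
      have := abs_real_inner_le_norm ν w
      rw [hν, one_mul] at this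
      linarith [neg_abs_le (inner ℝ ν w)]
    have h8 : L * ‖w‖ ≤ L * (δ * t) := mul_le_mul_of_nonneg_left hwn hL0
    have h9 : L * (δ * t) + δ * t < t := by nlinarith
    linarith

theorem volume_convexHull_eq_zero (s : Finset (Space n)) (hs : s.card ≤ n) :
    volume (convexHull ℝ (s : Set (Space n))) = 0 := by
  refine measure_mono_null (convexHull_subset_affineSpan _)
    (Measure.addHaar_affineSubspace volume _ fun htop => ?_)
  have hne : s.Nonempty := by
    rw [Finset.nonempty_iff_ne_empty]
    rintro rfl
    simp at htop
  have : Nonempty s := hne.to_subtype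
  have h1 := finrank_vectorSpan_range_add_one_le ℝ (fun i : s => (i : Space n))
  rw [Subtype.range_coe_subtype, ← direction_affineSpan, Finset.setOfPred_mem, htop,
    AffineSubspace.direction_top, finrank_top, finrank_euclideanSpace_fin, Fintype.card_coe] at h1
  omega

variable {T : Triangulation Ω} {s t : Finset (Space n)}

theorem Triangulation.mem_cells : s ∈ T.cells ↔ s ∈ T.faces ∧ s.card = n + 1 := by
  simp [Triangulation.cells]

theorem isOpen_cellInterior (s : Finset (Space n)) : IsOpen (cellInterior s) := isOpen_interior

theorem Triangulation.cellInterior_subset (hΩ : IsLipschitzDomain Ω) (hs : s ∈ T.cells) :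
    cellInterior s ⊆ Ω := by
  rw [← hΩ.interior_closure, ← T.space_eq]
  exact interior_mono (Geometry.SimplicialComplex.convexHull_subset_space (mem_cells.1 hs).1)

/-- Two distinct cells share at most n vertices, so they meet in a null set; an open null set is
empty. -/
theorem Triangulation.pairwiseDisjoint_cellInterior :
    (T.cells : Set (Finset (Space n))).PairwiseDisjoint cellInterior := by
  intro s hs t ht hst
  rw [Function.onFun, Set.disjoint_iff_inter_eq_empty]
  have hs := mem_cells.1 (Finset.mem_coe.1 hs)
  have ht := mem_cells.1 (Finset.mem_coe.1 ht)
  refine ((isOpen_cellInterior s).inter (isOpen_cellInterior t)).eq_empty_of_measure_zero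
    (μ := volume) ?_
  refine measure_mono_null (inter_subset_inter interior_subset interior_subset) ?_
  classical
  refine measure_mono_null (T.inter_subset_convexHull hs.1 ht.1) ?_
  rw [← Finset.coe_inter]
  refine volume_convexHull_eq_zero _ ?_
  by_contra! hcard
  have h1 : s ∩ t = s := Finset.eq_of_subset_of_card_le Finset.inter_subset_left (by omega)
  have h2 : s ∩ t = t := Finset.eq_of_subset_of_card_le Finset.inter_subset_right (by omega)
  exact hst (h1.symm.trans h2)

/-- A point of Ω in no cell interior lies in a simplex with at most n vertices or on the frontier of
a cell. Both kinds of set are null, the second by convexity. -/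
theorem Triangulation.ae_eq_biUnion_cellInterior (hΩ : IsLipschitzDomain Ω) :
    (⋃ s ∈ T.cells, cellInterior s : Set (Space n)) =ᵐ[volume] Ω := by
  have hle : (⋃ s ∈ T.cells, cellInterior s : Set (Space n)) ≤ Ω :=
    iUnion₂_subset fun s hs => T.cellInterior_subset hΩ hs
  refine hle.eventuallyLE.antisymm ?_
  rw [ae_le_set]
  have hsub : Ω \ (⋃ s ∈ T.cells, cellInterior s) ⊆
      (⋃ s ∈ T.finite_faces.toFinset.filter (fun s => s.card ≤ n), convexHull ℝ (s : Set (Space n)))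
      ∪ ⋃ s ∈ T.cells, frontier (convexHull ℝ (s : Set (Space n))) := by
    rintro x ⟨hx, hx'⟩
    have hx2 : x ∈ T.space := by rw [T.space_eq]; exact subset_closure hx
    obtain ⟨s, hs, hxs⟩ := Geometry.SimplicialComplex.mem_space_iff.1 hx2
    by_cases hcard : s.card ≤ n
    · left
      simp only [mem_iUnion]
      exact ⟨s, by simp [hs, hcard], hxs⟩
    · right
      have h1 : s.card ≤ n + 1 := by
        have := (T.indep hs).card_le_finrank_succ
        rw [Fintype.card_coe] at this
        refine this.trans (Nat.add_le_add_right ((Submodule.finrank_le _).trans ?_) 1)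
        rw [finrank_euclideanSpace_fin]
      have hs' : s ∈ T.cells := mem_cells.2 ⟨hs, by omega⟩
      simp only [mem_iUnion, not_exists] at hx' ⊢
      exact ⟨s, hs', subset_closure hxs, hx' s hs'⟩
  refine measure_mono_null hsub (measure_union_null ?_ ?_)
  · exact (measure_biUnion_null_iff (Finset.countable_toSet _)).2 fun s hs =>
      volume_convexHull_eq_zero s (Finset.mem_filter.1 hs).2
  · exact (measure_biUnion_null_iff (Finset.countable_toSet _)).2 fun s hs =>
      (convex_convexHull ℝ _).addHaar_frontier volume

end Geometry
end YangMills

namespace YangMills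

/-! ### Translations and mollification in dual Lebesgue spaces. -/

section Translation

open Set Filter Topology ContinuousLinearMap
open scoped Convolution

variable {E F G : Type*} [NormedAddCommGroup E] [NormedSpace ℝ E] [FiniteDimensional ℝ E]
  [MeasurableSpace E] [BorelSpace E] {μ : Measure E} [μ.IsAddHaarMeasure]
  [NormedAddCommGroup F] [NormedSpace ℝ F] [NormedAddCommGroup G] [NormedSpace ℝ G]
  {p q : ENNReal}

theorem integrable_bilin_of_memLp {α : Type*} [MeasurableSpace α] {ν : Measure α}
    [p.HolderConjugate q] (P : F →L[ℝ] G →L[ℝ] ℝ) {f : α → F} {g : α → G} (hf : MemLp f p ν)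
    (hg : MemLp g q ν) : Integrable (fun x => P (f x) (g x)) ν := by
  have h1 : Integrable (fun x => ‖P‖ * (‖f x‖ * ‖g x‖)) ν :=
    (hf.norm.integrable_mul hg.norm).const_mul _
  refine h1.mono' (P.aestronglyMeasurable_comp₂ hf.1 hg.1) (Eventually.of_forall fun x => ?_)
  rw [← mul_assoc]
  exact P.le_opNorm₂ _ _

/-- The pairing of an `L^p` function with the translates of an `L^q` function is a continuous
function of the translation. -/
theorem continuous_integral_translate [p.HolderConjugate q] (hq : q ≠ ⊤)
    (P : F →L[ℝ] G →L[ℝ] ℝ) {f : E → F} {g : E → G} (hf : MemLp f p μ) (hg : MemLp g q μ) :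
    Continuous fun z => ∫ x, P (f x) (g (x + z)) ∂μ := by
  have : Fact (1 ≤ p) := ⟨ENNReal.HolderConjugate.one_le p q⟩
  have : Fact (1 ≤ q) := ⟨ENNReal.HolderConjugate.one_le q p⟩
  have hmp : ∀ z : E, MeasurePreserving (fun x => x + z) μ μ := measurePreserving_add_right μ
  have hc : Continuous fun z : E => (⟨fun x => x + z, by fun_prop⟩ : C(E, E)) :=
    ContinuousMap.continuous_of_continuous_uncurry _ (by
      change Continuous fun p : E × E => p.2 + p.1
      fun_prop)
  -- Only `g` is translated, so only its exponent has to be finite; `f` may be in L^∞.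
  have h1 : Continuous fun z : E =>
      P.lpPairing μ p q (hf.toLp f) (Lp.compMeasurePreserving _ (hmp z) (hg.toLp g)) :=
    (ContinuousLinearMap.continuous _).comp
      ((continuous_const (y := hg.toLp g)).compMeasurePreservingLp hc hmp hq)
  refine h1.congr fun z => ?_
  rw [lpPairing_eq_integral]
  refine integral_congr_ae ?_
  have h2 := Lp.coeFn_compMeasurePreserving (hg.toLp g) (hmp z)
  have h3 := (hmp z).quasiMeasurePreserving.ae_eq_comp hg.coeFn_toLp
  filter_upwards [hf.coeFn_toLp, h2, h3] with x hx1 hx2 hx3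
  rw [hx1, hx2, hx3]
  rfl

/-- Fubini's theorem for the pairing of a mollified `L^p` function with an `L^q` function. -/
theorem integral_convolution_pairing [p.HolderConjugate q] (hq : q ≠ ⊤) [CompleteSpace F]
    (P : F →L[ℝ] G →L[ℝ] ℝ) {f : E → F} {g : E → G} (hf : MemLp f p μ) (hg : MemLp g q μ)
    {ρ : E → ℝ} (hρ : Continuous ρ) (hρc : HasCompactSupport ρ) :
    Integrable (fun x => P ((ρ ⋆[lsmul ℝ ℝ, μ] f) x) (g x)) μ ∧
    ∫ x, P ((ρ ⋆[lsmul ℝ ℝ, μ] f) x) (g x) ∂μ = ∫ z, ρ z * ∫ x, P (f x) (g (x + z)) ∂μ ∂μ := by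
  have hp1 : 1 ≤ p := ENNReal.HolderConjugate.one_le p q
  have hfl : LocallyIntegrable f μ := hf.locallyIntegrable hp1
  have hfm : AEStronglyMeasurable (fun a : E × E => f (a.1 - a.2)) (μ.prod μ) :=
    hf.1.comp_quasiMeasurePreserving (quasiMeasurePreserving_sub_of_right_invariant μ μ)
  have hgm : AEStronglyMeasurable (fun a : E × E => g a.1) (μ.prod μ) := hg.1.comp_fst
  have hρm : AEStronglyMeasurable (fun a : E × E => ρ a.2) (μ.prod μ) :=
    hρ.aestronglyMeasurable.comp_snd
  have htr : ∀ (z : E) (h : E → E → ℝ), ∫ x, h (x - z) x ∂μ = ∫ x, h x (x + z) ∂μ := by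
    intro z h
    rw [← integral_sub_right_eq_self (fun x => h x (x + z)) z]
    simp
  have hmpt : ∀ z : E, MemLp (fun x => f (x - z)) p μ := fun z =>
    hf.comp_measurePreserving (measurePreserving_sub_right μ z)
  -- For fixed z this is Hölder's inequality; the remaining integrand in z is continuous, by
  -- `continuous_integral_translate` applied to the norms, and has compact support.
  have hnorm : Integrable (fun a : E × E => ‖ρ a.2‖ * (‖f (a.1 - a.2)‖ * ‖g a.1‖)) (μ.prod μ) := by
    have hmeas : AEStronglyMeasurable (fun a : E × E => ‖ρ a.2‖ * (‖f (a.1 - a.2)‖ * ‖g a.1‖))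
        (μ.prod μ) := hρm.norm.mul (hfm.norm.mul hgm.norm)
    refine (integrable_prod_iff' hmeas).2 ⟨Eventually.of_forall fun z =>
      ((hmpt z).norm.integrable_mul hg.norm).const_mul ‖ρ z‖, ?_⟩
    have h1 : ∀ z, ∫ x, ‖‖ρ z‖ * (‖f (x - z)‖ * ‖g x‖)‖ ∂μ =
        ‖ρ z‖ * ∫ x, (ContinuousLinearMap.mul ℝ ℝ) ‖f x‖ ‖g (x + z)‖ ∂μ := by
      intro z
      simp only [norm_mul, norm_norm, ContinuousLinearMap.mul_apply']
      rw [integral_const_mul, htr z fun a b => ‖f a‖ * ‖g b‖]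
    simp only [h1]
    refine Continuous.integrable_of_hasCompactSupport ?_ hρc.norm.mul_right
    exact hρ.norm.mul (continuous_integral_translate hq _ hf.norm hg.norm)
  have hint : Integrable (fun a : E × E => ρ a.2 * P (f (a.1 - a.2)) (g a.1)) (μ.prod μ) := by
    refine (hnorm.const_mul ‖P‖).mono' (hρm.mul (P.aestronglyMeasurable_comp₂ hfm hgm))
      (Eventually.of_forall fun a => ?_)
    rw [norm_mul]
    calc ‖ρ a.2‖ * ‖P (f (a.1 - a.2)) (g a.1)‖
        ≤ ‖ρ a.2‖ * (‖P‖ * ‖f (a.1 - a.2)‖ * ‖g a.1‖) := by gcongr; exact P.le_opNorm₂ _ _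
      _ = _ := by ring
  have hpt : ∀ x, P ((ρ ⋆[lsmul ℝ ℝ, μ] f) x) (g x) =
      ∫ z, ρ z * P (f (x - z)) (g x) ∂μ := by
    intro x
    have hex : ConvolutionExistsAt ρ f x (lsmul ℝ ℝ) μ :=
      hρc.convolutionExists_left _ hρ hfl x
    have h1 := (P.flip (g x)).integral_comp_comm hex
    simp only [flip_apply, lsmul_apply, map_smul, smul_eq_mul] at h1
    exact h1.symm
  refine ⟨hint.integral_prod_left.congr (Eventually.of_forall fun x => (hpt x).symm), ?_⟩
  simp only [hpt]
  rw [integral_integral_swap hint]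
  refine integral_congr_ae (Eventually.of_forall fun z => ?_)
  dsimp only
  rw [integral_const_mul, htr z fun a b => P (f a) (g b)]

/-- A continuous function whose averages over small balls near the origin vanish is zero there. -/
theorem eq_zero_of_forall_integral_bump_eq_zero {g : E → ℝ} (hg : Continuous g) (ν : E) {δ t₀ : ℝ}
    (hδ : 0 < δ) (ht₀ : 0 < t₀)
    (h : ∀ t, 0 < t → t < t₀ → ∀ φ : ContDiffBump (t • ν), φ.rOut = δ * t →
      ∫ z, φ.normed μ z * g z ∂μ = 0) : g 0 = 0 := by
  rw [← abs_eq_zero]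
  refine le_antisymm (le_of_forall_pos_le_add fun ε hε => ?_) (abs_nonneg _)
  rw [zero_add]
  obtain ⟨r, hr, hball⟩ := Metric.continuous_iff.1 hg 0 ε hε
  -- The bump lives within distance t(‖ν‖ + δ) of the origin, which this choice makes less than r.
  set t : ℝ := min (t₀ / 2) (r / (2 * (‖ν‖ + δ))) with ht
  have hνδ : 0 < ‖ν‖ + δ := by positivity
  have htpos : 0 < t := by positivity
  have htlt : t < t₀ := (min_le_left _ _).trans_lt (by linarith)
  have htr : t * (‖ν‖ + δ) < r := by
    have : t ≤ r / (2 * (‖ν‖ + δ)) := min_le_right _ _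
    rw [le_div_iff₀ (by positivity)] at this
    linarith
  let φ : ContDiffBump (t • ν) := ⟨δ * t / 2, δ * t, by positivity, by linarith [mul_pos hδ htpos]⟩
  have h0 := h t htpos htlt φ rfl
  have hi : ∀ f : E → ℝ, Continuous f → Integrable (fun z => φ.normed μ z * f z) μ := fun f hf =>
    (φ.continuous_normed.mul hf).integrable_of_hasCompactSupport
      φ.hasCompactSupport_normed.mul_right
  have h1 : g 0 = ∫ z, φ.normed μ z * (g 0 - g z) ∂μ := by
    simp_rw [mul_sub]
    rw [integral_sub (hi _ continuous_const) (hi _ hg), h0, integral_mul_const, φ.integral_normed]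
    simp
  rw [h1, ← Real.norm_eq_abs]
  refine (norm_integral_le_of_norm_le ((hi (fun _ => ε) continuous_const))
    (Eventually.of_forall fun z => ?_)).trans ?_
  · rw [norm_mul, Real.norm_of_nonneg (φ.nonneg_normed z)]
    by_cases hz : z ∈ Function.support (φ.normed μ)
    · rw [φ.support_normed_eq, Metric.mem_ball] at hz
      refine mul_le_mul_of_nonneg_left ?_ (φ.nonneg_normed z)
      have : dist z 0 < r := by
        refine (dist_triangle z (t • ν) 0).trans_lt ?_
        rw [dist_zero_right, norm_smul, Real.norm_of_nonneg htpos.le]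
        have : dist z (t • ν) < δ * t := hz
        linarith
      have := hball z this
      rw [dist_comm, Real.dist_eq] at this
      exact this.le
    · rw [Function.notMem_support] at hz
      simp [hz]
  · rw [integral_mul_const, φ.integral_normed, one_mul]

end Translation
end YangMills

namespace YangMills

/-! ### Adjoint pairs of first order operators. -/

section FirstOrder

open Set Filter Topology ContinuousLinearMap
open scoped Convolution Pointwise

/-- A pair of first order differential operators with constant coefficients
`u ↦ symbolLeft (Du)` and `v ↦ symbolRight (Dv)`, which are (up to sign) formally adjoint to each
other with respect to a pair of bilinear forms. -/
structure FirstOrderDuality (E X Y W Z : Type*) [NormedAddCommGroup E] [NormedSpace ℝ E]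
    [NormedAddCommGroup X] [NormedSpace ℝ X] [NormedAddCommGroup Y] [NormedSpace ℝ Y]
    [NormedAddCommGroup W] [NormedSpace ℝ W] [NormedAddCommGroup Z] [NormedSpace ℝ Z] where
  /-- The symbol of the operator acting on `X`-valued functions. -/
  symbolLeft : (E →L[ℝ] X) →L[ℝ] W
  /-- The symbol of the operator acting on `Y`-valued functions. -/
  symbolRight : (E →L[ℝ] Y) →L[ℝ] Z
  /-- The pairing of the values of the first operator with `Y`. -/
  pairLeft : W →L[ℝ] Y →L[ℝ] ℝ
  /-- The pairing of `X` with the values of the second operator. -/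
  pairRight : X →L[ℝ] Z →L[ℝ] ℝ
  pair_symbol : ∀ (ℓ : E →L[ℝ] ℝ) (x : X) (y : Y),
    pairLeft (symbolLeft (ℓ.smulRight x)) y = pairRight x (symbolRight (ℓ.smulRight y))

variable {E X Y W Z : Type*} [NormedAddCommGroup E] [NormedSpace ℝ E]
  [NormedAddCommGroup X] [NormedSpace ℝ X] [NormedAddCommGroup Y] [NormedSpace ℝ Y]
  [NormedAddCommGroup W] [NormedSpace ℝ W] [NormedAddCommGroup Z] [NormedSpace ℝ Z]
  [FiniteDimensional ℝ E]

theorem clm_eq_sum_smulRight {ι : Type*} [Fintype ι] (e : Module.Basis ι ℝ E) (f : E →L[ℝ] X) :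
    f = ∑ i, (LinearMap.toContinuousLinearMap (e.coord i)).smulRight (f (e i)) := by
  ext v
  conv_lhs => rw [← e.sum_repr v, map_sum]
  simp

variable [MeasurableSpace E] [BorelSpace E] {μ : Measure E}

theorem integrable_bilin_of_hasCompactSupport {α : Type*} [TopologicalSpace α] [MeasurableSpace α]
    [OpensMeasurableSpace α] {ν : Measure α} [IsFiniteMeasureOnCompacts ν]
    (P : X →L[ℝ] Y →L[ℝ] ℝ) {f : α → X} {g : α → Y} (hf : Continuous f) (hg : Continuous g)
    (hfg : HasCompactSupport f ∨ HasCompactSupport g) :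
    Integrable (fun x => P (f x) (g x)) ν := by
  refine Continuous.integrable_of_hasCompactSupport (by fun_prop) ?_
  rcases hfg with hfg | hfg
  · refine HasCompactSupport.intro' hfg (isClosed_tsupport f) fun x hx => ?_
    rw [image_eq_zero_of_notMem_tsupport hx]; simp
  · refine HasCompactSupport.intro' hfg (isClosed_tsupport g) fun x hx => ?_
    rw [image_eq_zero_of_notMem_tsupport hx]; simp

theorem integrable_bilin_of_locallyIntegrableOn {U : Set E} (P : X →L[ℝ] Y →L[ℝ] ℝ) {f : E → X}
    {g : E → Y} (hf : LocallyIntegrableOn f U μ) (hg : Continuous g) (hc : HasCompactSupport g)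
    (hU : tsupport g ⊆ U) : Integrable (fun x => P (f x) (g x)) μ := by
  have h1 : IntegrableOn f (tsupport g) μ := hf.integrableOn_compact_subset hU hc
  have h2 : IntegrableOn (fun x => P (f x) (g x)) (tsupport g) μ := by
    obtain ⟨C, hC⟩ := hc.exists_bound_of_continuous hg
    refine Integrable.mono' (h1.norm.const_mul (‖P‖ * C))
      (P.aestronglyMeasurable_comp₂ h1.1 hg.aestronglyMeasurable)
      (Eventually.of_forall fun x => ?_)
    refine (P.le_opNorm₂ _ _).trans ?_
    rw [mul_right_comm]
    gcongr
    exact hC x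
  rw [← integrableOn_iff_integrable_of_support_subset (s := tsupport g)]
  · exact h2
  · intro x hx
    by_contra hxg
    exact hx (by simp [image_eq_zero_of_notMem_tsupport hxg])

/-- The fundamental lemma of the calculus of variations for a nondegenerate pairing. -/
theorem ae_eq_of_forall_integral_pair_eq [FiniteDimensional ℝ Y] (P : X →L[ℝ] Y →L[ℝ] ℝ)
    (hP : ∀ x, (∀ y, P x y = 0) → x = 0) {U : Set E} (hU : IsOpen U) {w w' : E → X}
    (hw : LocallyIntegrableOn w U μ) (hw' : LocallyIntegrableOn w' U μ)
    (heq : ∀ η : E → Y, ContDiff ℝ (⊤ : ℕ∞) η → HasCompactSupport η → tsupport η ⊆ U →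
      ∫ x in U, P (w x) (η x) ∂μ = ∫ x in U, P (w' x) (η x) ∂μ) :
    w =ᵐ[μ.restrict U] w' := by
  have key : ∀ y : Y, ∀ᵐ x ∂μ, x ∈ U → P (w x - w' x) y = 0 := by
    intro y
    refine hU.ae_eq_zero_of_integral_contDiff_smul_eq_zero ?_ fun g hg hgc hgU => ?_
    · intro x hx
      obtain ⟨s, hs, his⟩ := (hw.sub hw') x hx
      exact ⟨s, hs, (P.flip y).integrable_comp his⟩
    · have hηs : tsupport (fun x => g x • y) ⊆ tsupport g := tsupport_smul_subset_left g _
      have hη : ContDiff ℝ (⊤ : ℕ∞) (fun x => g x • y) := hg.smul contDiff_const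
      have hηc : HasCompactSupport (fun x => g x • y) := hgc.smul_right
      have h2 := heq _ hη hηc (hηs.trans hgU)
      have i1 := integrable_bilin_of_locallyIntegrableOn P hw hη.continuous hηc (hηs.trans hgU)
      have i2 := integrable_bilin_of_locallyIntegrableOn P hw' hη.continuous hηc (hηs.trans hgU)
      have hz : ∀ v : E → X, ∀ x, x ∉ U → P (v x) (g x • y) = 0 := by
        intro v x hx
        rw [image_eq_zero_of_notMem_tsupport fun h => hx (hgU h), zero_smul, map_zero]
      rw [setIntegral_eq_integral_of_forall_compl_eq_zero (hz w),
        setIntegral_eq_integral_of_forall_compl_eq_zero (hz w'), ← sub_eq_zero,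
        ← integral_sub i1 i2] at h2
      rw [← h2]
      refine integral_congr_ae (Eventually.of_forall fun x => ?_)
      simp only [map_sub, map_smul, smul_eq_mul, _root_.sub_apply]
      ring
  -- The exceptional null set depends on y; a finite basis gives a common one.
  let b := Module.finBasis ℝ Y
  have h3 : ∀ᵐ x ∂μ, ∀ i, x ∈ U → P (w x - w' x) (b i) = 0 := ae_all_iff.2 fun i => key (b i)
  rw [EventuallyEq, ae_restrict_iff' hU.measurableSet]
  filter_upwards [h3] with x hx hxU
  rw [← sub_eq_zero]
  refine hP _ fun y => ?_
  have h4 : (P (w x - w' x)).toLinearMap = 0 := b.ext fun i => hx i hxU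
  exact LinearMap.congr_fun h4 y

variable [μ.IsAddHaarMeasure]

/-- Integration by parts for smooth functions, one of which has compact support. -/
theorem FirstOrderDuality.integral_smooth (S : FirstOrderDuality E X Y W Z) {u : E → X} {η : E → Y}
    (hu : ContDiff ℝ (⊤ : ℕ∞) u) (hη : ContDiff ℝ (⊤ : ℕ∞) η)
    (hc : HasCompactSupport u ∨ HasCompactSupport η) :
    ∫ x, S.pairLeft (S.symbolLeft (fderiv ℝ u x)) (η x) ∂μ +
      ∫ x, S.pairRight (u x) (S.symbolRight (fderiv ℝ η x)) ∂μ = 0 := by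
  let e := Module.finBasis ℝ E
  have hud : ∀ i, Continuous fun x => fderiv ℝ u x (e i) := fun i =>
    (hu.continuous_fderiv (by simp)).clm_apply continuous_const
  have hηd : ∀ i, Continuous fun x => fderiv ℝ η x (e i) := fun i =>
    (hη.continuous_fderiv (by simp)).clm_apply continuous_const
  let ℓ := fun i => LinearMap.toContinuousLinearMap (e.coord i)
  -- By `pair_symbol`, the same form `Q i` expresses the i-th directional part of both operators, so
  -- ordinary integration by parts applies direction by direction.
  let Q : Fin _ → X →L[ℝ] Y →L[ℝ] ℝ := fun i =>
    S.pairLeft.comp (S.symbolLeft.comp (smulRightL ℝ E X (ℓ i)))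
  have hQ : ∀ i a b, Q i a b = S.pairLeft (S.symbolLeft ((ℓ i).smulRight a)) b := fun _ _ _ => rfl
  have hc1 : ∀ i, HasCompactSupport (fun x => fderiv ℝ u x (e i)) ∨ HasCompactSupport η :=
    fun i => hc.imp (fun h => h.fderiv_apply ℝ _) id
  have hc2 : ∀ i, HasCompactSupport u ∨ HasCompactSupport (fun x => fderiv ℝ η x (e i)) :=
    fun i => hc.imp id (fun h => h.fderiv_apply ℝ _)
  have i1 := fun i => integrable_bilin_of_hasCompactSupport (ν := μ) (Q i) (hud i) hη.continuous
    (hc1 i)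
  have i2 := fun i => integrable_bilin_of_hasCompactSupport (ν := μ) (Q i) hu.continuous (hηd i)
    (hc2 i)
  have e1 : ∫ x, S.pairLeft (S.symbolLeft (fderiv ℝ u x)) (η x) ∂μ =
      ∑ i, ∫ x, Q i (fderiv ℝ u x (e i)) (η x) ∂μ := by
    rw [← integral_finsetSum _ fun i _ => i1 i]
    refine integral_congr_ae (Eventually.of_forall fun x => ?_)
    dsimp only
    conv_lhs => rw [clm_eq_sum_smulRight e (fderiv ℝ u x)]
    simp only [map_sum, _root_.sum_apply, hQ, ℓ]
  have e2 : ∫ x, S.pairRight (u x) (S.symbolRight (fderiv ℝ η x)) ∂μ =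
      ∑ i, ∫ x, Q i (u x) (fderiv ℝ η x (e i)) ∂μ := by
    rw [← integral_finsetSum _ fun i _ => i2 i]
    refine integral_congr_ae (Eventually.of_forall fun x => ?_)
    dsimp only
    conv_lhs => rw [clm_eq_sum_smulRight e (fderiv ℝ η x)]
    simp only [map_sum, hQ, S.pair_symbol, ℓ]
  rw [e1, e2, ← Finset.sum_add_distrib]
  refine Finset.sum_eq_zero fun i _ => ?_
  rw [integral_bilinear_fderiv_right_eq_neg_left_of_integrable (i1 i) (i2 i)
    (integrable_bilin_of_hasCompactSupport _ hu.continuous hη.continuous hc)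
    (fun x _ => hu.differentiable (by simp) x) (fun x _ => hη.differentiable (by simp) x),
    add_neg_cancel]

variable {p p' q q' : ENNReal} [CompleteSpace X] [CompleteSpace W]

/-- If `w` is the weak image of `u` on the whole space, then the mollification of `w` is the image
of the mollification of `u`. -/
theorem FirstOrderDuality.pair_convolution (S : FirstOrderDuality E X Y W Z) {u : E → X} {w : E → W}
    (hu : LocallyIntegrable u μ) (hw : LocallyIntegrable w μ)
    (huw : ∀ η : E → Y, ContDiff ℝ (⊤ : ℕ∞) η →
      ∫ x, S.pairLeft (w x) (η x) ∂μ + ∫ x, S.pairRight (u x) (S.symbolRight (fderiv ℝ η x)) ∂μ = 0)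
    {ρ : E → ℝ} (hρ : ContDiff ℝ (⊤ : ℕ∞) ρ) (hρc : HasCompactSupport ρ) (x : E) (y : Y) :
    S.pairLeft (S.symbolLeft (fderiv ℝ (ρ ⋆[lsmul ℝ ℝ, μ] u) x)) y =
      S.pairLeft ((ρ ⋆[lsmul ℝ ℝ, μ] w) x) y := by
  have hρ1 : ContDiff ℝ 1 ρ := hρ.of_le (by simp)
  have h1 := (hρc.hasFDerivAt_convolution_left (lsmul ℝ ℝ (E := X)) hρ1 hu x).fderiv
  have hex : ConvolutionExistsAt (fderiv ℝ ρ) u x ((lsmul ℝ ℝ (E := X)).precompL E) μ :=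
    (hρc.fderiv ℝ).convolutionExists_left _ (hρ.continuous_fderiv (by simp)) hu x
  have hew : ConvolutionExistsAt ρ w x (lsmul ℝ ℝ) μ :=
    hρc.convolutionExists_left _ hρ.continuous hw x
  have e1 : S.pairLeft (S.symbolLeft (fderiv ℝ (ρ ⋆[lsmul ℝ ℝ, μ] u) x)) y =
      ∫ t, S.pairRight (u t) (S.symbolRight ((fderiv ℝ ρ (x - t)).smulRight y)) ∂μ := by
    rw [h1, convolution_def]
    have := ((S.pairLeft.flip y).comp S.symbolLeft).integral_comp_comm hex
    simp only [ContinuousLinearMap.comp_apply, flip_apply] at this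
    rw [← this, ← integral_sub_left_eq_self _ μ x]
    refine integral_congr_ae (Eventually.of_forall fun t => ?_)
    dsimp only
    rw [← S.pair_symbol, sub_sub_cancel]
    congr 3
  have e2 : S.pairLeft ((ρ ⋆[lsmul ℝ ℝ, μ] w) x) y =
      ∫ t, S.pairLeft (w t) (ρ (x - t) • y) ∂μ := by
    rw [convolution_def]
    have := (S.pairLeft.flip y).integral_comp_comm hew
    simp only [flip_apply] at this
    rw [← this, ← integral_sub_left_eq_self _ μ x]
    refine integral_congr_ae (Eventually.of_forall fun t => ?_)
    simp
  -- Testing with the reflected mollifier puts the derivative on ρ.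
  have h2 := huw (fun t => ρ (x - t) • y)
    ((hρ.comp (contDiff_const.sub contDiff_id)).smul contDiff_const)
  have h3 : ∀ t, fderiv ℝ (fun t => ρ (x - t) • y) t = -((fderiv ℝ ρ (x - t)).smulRight y) := by
    intro t
    have hd : HasFDerivAt (fun t => ρ (x - t)) (-(fderiv ℝ ρ (x - t))) t := by
      have := ((hρ.differentiable (by simp) (x - t)).hasFDerivAt).comp t
        ((hasFDerivAt_id t).const_sub x)
      rwa [show (fderiv ℝ ρ (x - t)).comp (-ContinuousLinearMap.id ℝ E) = -(fderiv ℝ ρ (x - t)) by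
        ext; simp] at this
    rw [(hd.smul_const y).fderiv]
    ext; simp
  simp only [h3, map_neg, integral_neg, ← e1, ← e2] at h2
  linarith

end FirstOrder
end YangMills

namespace YangMills

/-! ### Green's formula for rough functions. -/

section Duality

open Set Filter Topology ContinuousLinearMap
open scoped Convolution Pointwise ContDiff Manifold

variable {E X Y W Z : Type*} [NormedAddCommGroup E] [NormedSpace ℝ E]
  [NormedAddCommGroup X] [NormedSpace ℝ X] [NormedAddCommGroup Y] [NormedSpace ℝ Y]
  [NormedAddCommGroup W] [NormedSpace ℝ W] [NormedAddCommGroup Z] [NormedSpace ℝ Z]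
  [FiniteDimensional ℝ E] [MeasurableSpace E] [BorelSpace E] {μ : Measure E} [μ.IsAddHaarMeasure]
  {p p' q q' : ENNReal}

theorem memLp_smul_of_hasCompactSupport {α V : Type*} [TopologicalSpace α] [MeasurableSpace α]
    [OpensMeasurableSpace α] {ν : Measure α} [NormedAddCommGroup V] [NormedSpace ℝ V] {χ : α → ℝ}
    (hχ : Continuous χ) (hχc : HasCompactSupport χ) {f : α → V} (hf : MemLp f p ν) :
    MemLp (fun x => χ x • f x) p ν := by
  obtain ⟨C, hC⟩ := hχc.exists_bound_of_continuous hχ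
  refine hf.of_le_mul (c := C) (hχ.aestronglyMeasurable.smul hf.1)
    (Eventually.of_forall fun x => ?_)
  rw [norm_smul]
  exact mul_le_mul_of_nonneg_right (hC x) (norm_nonneg _)

theorem integral_bilin_indicator_left {α : Type*} [MeasurableSpace α] {ν : Measure α} {U : Set α}
    (hU : MeasurableSet U) (P : X →L[ℝ] Y →L[ℝ] ℝ) (f : α → X) (g : α → Y) :
    ∫ x, P (U.indicator f x) (g x) ∂ν = ∫ x in U, P (f x) (g x) ∂ν := by
  rw [← integral_indicator hU]
  refine integral_congr_ae (Eventually.of_forall fun x => ?_)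
  by_cases hx : x ∈ U <;> simp [hx]

theorem integral_bilin_indicator_right {α : Type*} [MeasurableSpace α] {ν : Measure α} {U : Set α}
    (hU : MeasurableSet U) (P : X →L[ℝ] Y →L[ℝ] ℝ) (f : α → X) (g : α → Y) :
    ∫ x, P (f x) (U.indicator g x) ∂ν = ∫ x in U, P (f x) (g x) ∂ν := by
  rw [← integral_indicator hU]
  refine integral_congr_ae (Eventually.of_forall fun x => ?_)
  by_cases hx : x ∈ U <;> simp [hx]

variable [CompleteSpace X] [CompleteSpace W]

/-- Integration by parts for a pair of weakly differentiable functions, one of which has its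
support in a compact set that can be pushed into the interior of the domain of the other. -/
theorem FirstOrderDuality.integral_eq_zero_of_support (S : FirstOrderDuality E X Y W Z)
    [p.HolderConjugate p'] [q.HolderConjugate q'] (hp' : p' ≠ ⊤) (hq' : q' ≠ ⊤)
    {U K : Set E} (hK : IsCompact K) {ν : E} {δ t₀ : ℝ} (hδ : 0 < δ) (ht₀ : 0 < t₀)
    (hcone : ∀ t, 0 < t → t < t₀ → ∀ y ∈ K, Metric.closedBall (y + t • ν) (δ * t) ⊆ U)
    {u : E → X} {w : E → W} {D : E → Y} {v : E → Z} (hu : MemLp u p μ) (hw : MemLp w q μ)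
    (hD : MemLp D q' μ) (hv : MemLp v p' μ) (huK : ∀ x ∉ K, u x = 0)
    (huw : ∀ η : E → Y, ContDiff ℝ (⊤ : ℕ∞) η →
      ∫ x, S.pairLeft (w x) (η x) ∂μ + ∫ x, S.pairRight (u x) (S.symbolRight (fderiv ℝ η x)) ∂μ = 0)
    (hDv : ∀ η : E → X, ContDiff ℝ (⊤ : ℕ∞) η → HasCompactSupport η → tsupport η ⊆ U →
      ∫ x, S.pairLeft (S.symbolLeft (fderiv ℝ η x)) (D x) ∂μ +
        ∫ x, S.pairRight (η x) (v x) ∂μ = 0) :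
    ∫ x, S.pairLeft (w x) (D x) ∂μ + ∫ x, S.pairRight (u x) (v x) ∂μ = 0 := by
  have hul : LocallyIntegrable u μ := hu.locallyIntegrable (ENNReal.HolderConjugate.one_le p p')
  have hwl : LocallyIntegrable w μ := hw.locallyIntegrable (ENNReal.HolderConjugate.one_le q q')
  have c1 := continuous_integral_translate hq' S.pairLeft hw hD
  have c2 := continuous_integral_translate hp' S.pairRight hu hv
  -- The claim is the value at z = 0 of a continuous function of the translation, so it is enough
  -- that its averages against bumps at tν vanish.
  have key := eq_zero_of_forall_integral_bump_eq_zero (μ := μ) (c1.add c2) ν hδ ht₀ ?_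
  · simpa using key
  intro t ht ht' φ hφ
  have hρc : HasCompactSupport (φ.normed μ) := φ.hasCompactSupport_normed
  have hρ : ContDiff ℝ (⊤ : ℕ∞) (φ.normed μ) := φ.contDiff_normed
  have hi : ∀ f : E → ℝ, Continuous f → Integrable (fun z => φ.normed μ z * f z) μ := fun f hf =>
    (φ.continuous_normed.mul hf).integrable_of_hasCompactSupport hρc.mul_right
  simp only [Pi.add_apply, mul_add]
  rw [integral_add (hi _ c1) (hi _ c2),
    ← (integral_convolution_pairing hq' S.pairLeft hw hD φ.continuous_normed hρc).2,
    ← (integral_convolution_pairing hp' S.pairRight hu hv φ.continuous_normed hρc).2]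
  have hcl : IsCompact (K + Metric.closedBall (t • ν) (δ * t)) :=
    hK.add (isCompact_closedBall _ _)
  have hsupp : tsupport (φ.normed μ ⋆[lsmul ℝ ℝ, μ] u) ⊆
      K + Metric.closedBall (t • ν) (δ * t) := by
    refine closure_minimal ?_ hcl.isClosed
    refine (support_convolution_subset _).trans ?_
    rw [add_comm]
    refine Set.add_subset_add (fun x hx => ?_) ?_
    · by_contra hxK
      exact hx (huK x hxK)
    · rw [φ.support_normed_eq, hφ]
      exact Metric.ball_subset_closedBall
  -- The cone condition keeps the support of the mollified `u` inside U, which makes it an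
  -- admissible test function.
  have h1 := hDv (φ.normed μ ⋆[lsmul ℝ ℝ, μ] u) (hρc.contDiff_convolution_left _ hρ hul)
    (hcl.of_isClosed_subset (isClosed_tsupport _) hsupp) (hsupp.trans ?_)
  · simp only [S.pair_convolution hul hwl huw hρ hρc] at h1
    exact h1
  · rintro _ ⟨y, hy, z, hz, rfl⟩
    refine hcone t ht ht' y hy ?_
    rw [Metric.mem_closedBall] at hz ⊢
    simpa using hz

/-- Local form of integration by parts for a pair of weakly differentiable functions. -/
theorem FirstOrderDuality.integral_localized_eq_zero (S : FirstOrderDuality E X Y W Z)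
    [p.HolderConjugate p'] [q.HolderConjugate q'] (hp' : p' ≠ ⊤) (hq' : q' ≠ ⊤) (hqp : q ≤ p)
    {U : Set E} (hU : IsOpen U) (hUb : Bornology.IsBounded U) {x₀ ν : E} {r δ t₀ : ℝ} (hδ : 0 < δ)
    (ht₀ : 0 < t₀) (hcone : ∀ t, 0 < t → t < t₀ → ∀ y ∈ closure U ∩ Metric.ball x₀ r,
      Metric.closedBall (y + t • ν) (δ * t) ⊆ U)
    {u : E → X} {w : E → W} {D : E → Y} {v : E → Z} (hu : MemLp u p (μ.restrict U))
    (hw : MemLp w q (μ.restrict U)) (hD : MemLp D q' (μ.restrict U))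
    (hv : MemLp v p' (μ.restrict U))
    (huw : ∀ η : E → Y, ContDiff ℝ (⊤ : ℕ∞) η → ∫ x in U, S.pairLeft (w x) (η x) ∂μ +
      ∫ x in U, S.pairRight (u x) (S.symbolRight (fderiv ℝ η x)) ∂μ = 0)
    (hDv : ∀ η : E → X, ContDiff ℝ (⊤ : ℕ∞) η → HasCompactSupport η → tsupport η ⊆ U →
      ∫ x in U, S.pairLeft (S.symbolLeft (fderiv ℝ η x)) (D x) ∂μ +
        ∫ x in U, S.pairRight (η x) (v x) ∂μ = 0)
    {χ : E → ℝ} (hχ : ContDiff ℝ (⊤ : ℕ∞) χ) (hχs : tsupport χ ⊆ Metric.ball x₀ r) :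
    MemLp (fun x => χ x • w x + S.symbolLeft ((fderiv ℝ χ x).smulRight (u x))) q (μ.restrict U) ∧
    MemLp (fun x => χ x • u x) p (μ.restrict U) ∧
    ∫ x in U, S.pairLeft (χ x • w x + S.symbolLeft ((fderiv ℝ χ x).smulRight (u x))) (D x) ∂μ +
      ∫ x in U, S.pairRight (χ x • u x) (v x) ∂μ = 0 := by
  have hfin : IsFiniteMeasure (μ.restrict U) := ⟨by
    rw [Measure.restrict_apply_univ]; exact hUb.measure_lt_top⟩
  have hχc : HasCompactSupport χ :=
    Metric.isCompact_of_isClosed_isBounded (isClosed_tsupport χ) (Metric.isBounded_ball.subset hχs)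
  have hdχ : Continuous (fderiv ℝ χ) := hχ.continuous_fderiv (by simp)
  obtain ⟨C', hC'⟩ := (hχc.fderiv ℝ).exists_bound_of_continuous hdχ
  have hsu := memLp_smul_of_hasCompactSupport hχ.continuous hχc hu
  -- The cutoff produces a term dχ · u with only the integrability of `u`; on a bounded U, q ≤ p
  -- puts it in L^q.
  have hda : MemLp (fun x => S.symbolLeft ((fderiv ℝ χ x).smulRight (u x))) q (μ.restrict U) := by
    refine (hu.mono_exponent hqp).of_le_mul (c := ‖S.symbolLeft‖ * C')
      (S.symbolLeft.continuous.comp_aestronglyMeasurable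
        ((smulRightL ℝ E X).aestronglyMeasurable_comp₂ hdχ.aestronglyMeasurable hu.1))
      (Eventually.of_forall fun x => ?_)
    refine (S.symbolLeft.le_opNorm _).trans ?_
    rw [norm_smulRight_apply, mul_assoc]
    gcongr
    exact hC' x
  have hsw : MemLp (fun x => χ x • w x + S.symbolLeft ((fderiv ℝ χ x).smulRight (u x))) q
      (μ.restrict U) := (memLp_smul_of_hasCompactSupport hχ.continuous hχc hw).add hda
  refine ⟨hsw, hsu, ?_⟩
  have hUm := hU.measurableSet
  have hK : IsCompact (closure U ∩ tsupport χ) :=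
    hUb.isCompact_closure.inter_right (isClosed_tsupport χ)
  -- All four functions are extended by zero. No boundary term arises for the first pair, because
  -- `huw` admits test functions that do not vanish on the boundary of U.
  have hsuU := (memLp_indicator_iff_restrict hUm).2 hsu
  have hswU := (memLp_indicator_iff_restrict hUm).2 hsw
  have hDU := (memLp_indicator_iff_restrict hUm).2 hD
  have hvU := (memLp_indicator_iff_restrict hUm).2 hv
  have hcone' : ∀ t, 0 < t → t < t₀ → ∀ y ∈ closure U ∩ tsupport χ,
      Metric.closedBall (y + t • ν) (δ * t) ⊆ U :=
    fun t ht ht' y hy => hcone t ht ht' y ⟨hy.1, hχs hy.2⟩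
  have := S.integral_eq_zero_of_support hp' hq' hK hδ ht₀ hcone' hsuU hswU hDU hvU ?_ ?_ ?_
  · rw [integral_bilin_indicator_right hUm, integral_bilin_indicator_right hUm] at this
    rw [← this]
    congr 1 <;>
    · refine setIntegral_congr_fun hUm fun x hx => ?_
      simp [indicator_of_mem hx]
  · intro x hx
    by_cases hxU : x ∈ U
    · have hxχ : χ x = 0 :=
        image_eq_zero_of_notMem_tsupport fun h => hx ⟨subset_closure hxU, h⟩
      rw [indicator_of_mem hxU, hxχ, zero_smul]
    · exact indicator_of_notMem hxU _
  · intro η hη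
    rw [integral_bilin_indicator_left hUm, integral_bilin_indicator_left hUm]
    -- By the product rule, testing with χη creates a term with dχ on η; `pair_symbol` moves it onto
    -- `u`, where it is the correction to χw.
    have h1 := huw (fun x => χ x • η x) (hχ.smul hη)
    have hdη : Continuous (fderiv ℝ η) := hη.continuous_fderiv (by simp)
    have hcont : Continuous fun x => S.symbolRight ((fderiv ℝ χ x).smulRight (η x)) :=
      S.symbolRight.continuous.comp (((smulRightL ℝ E Y).continuous.comp hdχ).clm_apply hη.continuous)
    have hcomp : HasCompactSupport fun x => S.symbolRight ((fderiv ℝ χ x).smulRight (η x)) := by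
      refine HasCompactSupport.intro' (hχc.fderiv ℝ) (isClosed_tsupport _) fun x hx => ?_
      have h0 : fderiv ℝ χ x = 0 := image_eq_zero_of_notMem_tsupport hx
      rw [h0, show (0 : E →L[ℝ] ℝ).smulRight (η x) = 0 by ext; simp, map_zero]
    have i1 : Integrable (fun x => S.pairLeft (w x) (χ x • η x)) (μ.restrict U) :=
      integrable_bilin_of_memLp (q := q') S.pairLeft hw
        (((hχ.continuous.smul hη.continuous).memLp_of_hasCompactSupport hχc.smul_right).restrict U)
    have i2 : Integrable (fun x => S.pairRight (u x)
        (S.symbolRight ((fderiv ℝ χ x).smulRight (η x)))) (μ.restrict U) :=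
      integrable_bilin_of_memLp (q := p') S.pairRight hu
        ((hcont.memLp_of_hasCompactSupport hcomp).restrict U)
    have i3 : Integrable (fun x => S.pairRight (u x) (χ x • S.symbolRight (fderiv ℝ η x)))
        (μ.restrict U) :=
      integrable_bilin_of_memLp (q := p') S.pairRight hu
        (((hχ.continuous.smul (S.symbolRight.continuous.comp hdη)).memLp_of_hasCompactSupport
          hχc.smul_right).restrict U)
    have e1 : ∀ x, S.pairLeft (χ x • w x + S.symbolLeft ((fderiv ℝ χ x).smulRight (u x))) (η x) =
        S.pairLeft (w x) (χ x • η x) +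
          S.pairRight (u x) (S.symbolRight ((fderiv ℝ χ x).smulRight (η x))) := fun x => by
      rw [map_add, _root_.add_apply, S.pair_symbol, map_smul, map_smul, _root_.smul_apply]
    have e2 : ∀ x, S.pairRight (u x) (S.symbolRight (fderiv ℝ (fun x => χ x • η x) x)) =
        S.pairRight (u x) (χ x • S.symbolRight (fderiv ℝ η x)) +
          S.pairRight (u x) (S.symbolRight ((fderiv ℝ χ x).smulRight (η x))) := fun x => by
      rw [fderiv_fun_smul (hχ.differentiable (by simp) x) (hη.differentiable (by simp) x), map_add,
        map_add, map_smul]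
    have e3 : ∀ x, S.pairRight (χ x • u x) (S.symbolRight (fderiv ℝ η x)) =
        S.pairRight (u x) (χ x • S.symbolRight (fderiv ℝ η x)) := fun x => by
      rw [map_smul, map_smul, _root_.smul_apply]
    simp only [e1, e2, e3] at h1 ⊢
    rw [integral_add i3 i2] at h1
    rw [integral_add i1 i2]
    linarith
  · intro η h1 h2 h3
    rw [integral_bilin_indicator_right hUm, integral_bilin_indicator_right hUm]
    exact hDv η h1 h2 h3

/-- **Green's formula** for a pair of weakly differentiable functions on a bounded domain with the
uniform cone property, the first of which has vanishing trace. -/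
theorem FirstOrderDuality.integral_eq_zero (S : FirstOrderDuality E X Y W Z)
    [p.HolderConjugate p'] [q.HolderConjugate q'] (hp' : p' ≠ ⊤) (hq' : q' ≠ ⊤) (hqp : q ≤ p)
    {U : Set E} (hU : IsOpen U) (hUb : Bornology.IsBounded U)
    (hcone : ∀ x ∈ closure U, ∃ (ν : E) (r δ t₀ : ℝ), 0 < r ∧ 0 < δ ∧ 0 < t₀ ∧ ∀ t, 0 < t → t < t₀ →
      ∀ y ∈ closure U ∩ Metric.ball x r, Metric.closedBall (y + t • ν) (δ * t) ⊆ U)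
    {u : E → X} {w : E → W} {D : E → Y} {v : E → Z} (hu : MemLp u p (μ.restrict U))
    (hw : MemLp w q (μ.restrict U)) (hD : MemLp D q' (μ.restrict U))
    (hv : MemLp v p' (μ.restrict U))
    (huw : ∀ η : E → Y, ContDiff ℝ (⊤ : ℕ∞) η → ∫ x in U, S.pairLeft (w x) (η x) ∂μ +
      ∫ x in U, S.pairRight (u x) (S.symbolRight (fderiv ℝ η x)) ∂μ = 0)
    (hDv : ∀ η : E → X, ContDiff ℝ (⊤ : ℕ∞) η → HasCompactSupport η → tsupport η ⊆ U →
      ∫ x in U, S.pairLeft (S.symbolLeft (fderiv ℝ η x)) (D x) ∂μ +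
        ∫ x in U, S.pairRight (η x) (v x) ∂μ = 0) :
    ∫ x in U, S.pairLeft (w x) (D x) ∂μ + ∫ x in U, S.pairRight (u x) (v x) ∂μ = 0 := by
  have hK : IsCompact (closure U) := hUb.isCompact_closure
  choose! ν r δ t₀ hr hδ ht₀ hc using hcone
  obtain ⟨s, hs, hcover⟩ := hK.elim_nhds_subcover (fun x => Metric.ball x (r x))
    fun x hx => Metric.ball_mem_nhds x (hr x hx)
  obtain ⟨f, hf⟩ := SmoothPartitionOfUnity.exists_isSubordinate 𝓘(ℝ, E) (isClosed_closure (s := U))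
    (fun i : s => Metric.ball (i : E) (r i)) (fun i => Metric.isOpen_ball) (by
      intro x hx
      obtain ⟨i, hi, hxi⟩ := mem_iUnion₂.1 (hcover hx)
      exact mem_iUnion.2 ⟨⟨i, hi⟩, hxi⟩)
  have hsum : ∀ x ∈ closure U, ∑ i, f i x = 1 := fun x hx => by
    rw [← finsum_eq_sum_of_fintype]; exact f.sum_eq_one hx
  have hfs : ∀ i, ContDiff ℝ (⊤ : ℕ∞) (f i) := fun i => (f i).contMDiff.contDiff
  have hloc := fun i : s => S.integral_localized_eq_zero hp' hq' hqp hU hUb (hδ i (hs i i.2))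
    (ht₀ i (hs i i.2)) (hc i (hs i i.2)) hu hw hD hv huw hDv (hfs i) (hf i)
  -- The partition sums to 1 near each point of the open set U, so the correction terms cancel in
  -- the sum.
  have hdsum : ∀ x ∈ U, ∑ i, fderiv ℝ (f i) x = 0 := fun x hx => by
    rw [← fderiv_fun_sum fun i _ => (hfs i).differentiable (by simp) x]
    have : (fun y => ∑ i, f i y) =ᶠ[𝓝 x] fun _ => 1 := by
      filter_upwards [hU.mem_nhds hx] with y hy using hsum y (subset_closure hy)
    rw [this.fderiv_eq]
    simp
  have e1 : ∫ x in U, S.pairLeft (w x) (D x) ∂μ = ∑ i, ∫ x in U,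
      S.pairLeft (f i x • w x + S.symbolLeft ((fderiv ℝ (f i) x).smulRight (u x))) (D x) ∂μ := by
    rw [← integral_finsetSum _ fun i _ => integrable_bilin_of_memLp S.pairLeft (hloc i).1 hD]
    refine setIntegral_congr_fun hU.measurableSet fun x hx => ?_
    rw [← _root_.sum_apply, ← map_sum, Finset.sum_add_distrib, ← Finset.sum_smul,
      hsum x (subset_closure hx), one_smul, ← map_sum]
    have : ∑ i, (fderiv ℝ (f i) x).smulRight (u x) = 0 := by
      ext y
      have := congrArg (fun g : E →L[ℝ] ℝ => g y • u x) (hdsum x hx)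
      simpa [Finset.sum_smul] using this
    rw [this, map_zero, add_zero]
  have e2 : ∫ x in U, S.pairRight (u x) (v x) ∂μ = ∑ i, ∫ x in U,
      S.pairRight (f i x • u x) (v x) ∂μ := by
    rw [← integral_finsetSum _ fun i _ => integrable_bilin_of_memLp S.pairRight (hloc i).2.1 hv]
    refine setIntegral_congr_fun hU.measurableSet fun x hx => ?_
    rw [← _root_.sum_apply, ← map_sum, ← Finset.sum_smul, hsum x (subset_closure hx), one_smul]
  rw [e1, e2, ← Finset.sum_add_distrib]
  exact Finset.sum_eq_zero fun i _ => (hloc i).2.2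

end Duality
end YangMills

namespace YangMills

/-! ### Weak exterior derivatives of forms. -/

section Forms

open Set Filter Topology

/-- A bilinear form on finite-dimensional spaces as a continuous bilinear form. -/
noncomputable def continuousBilin {X Y : Type*} [NormedAddCommGroup X] [NormedSpace ℝ X]
    [FiniteDimensional ℝ X] [NormedAddCommGroup Y] [NormedSpace ℝ Y] [FiniteDimensional ℝ Y]
    (B : X →ₗ[ℝ] Y →ₗ[ℝ] ℝ) : X →L[ℝ] Y →L[ℝ] ℝ :=
  LinearMap.toContinuousLinearMap
    ((LinearMap.toContinuousLinearMap (𝕜 := ℝ) (E := Y) (F' := ℝ)).toLinearMap ∘ₗ B)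

variable {n k l m : ℕ} {𝔤 : Type*} [NormedAddCommGroup 𝔤] [InnerProductSpace ℝ 𝔤]

instance finiteDimensional_covector [FiniteDimensional ℝ 𝔤] :
    FiniteDimensional ℝ (Covector n k 𝔤) :=
  FiniteDimensional.of_injective
    ((AlternatingMap.toMultilinearMapLM (S := ℝ)).comp
      (ContinuousAlternatingMap.toAlternatingMapLinear (R := ℝ) (A := ℝ) (M := Space n) (N := 𝔤)
        (ι := Fin k)))
    (AlternatingMap.coe_multilinearMap_injective.comp
      ContinuousAlternatingMap.toAlternatingMap_injective)

theorem wedgeCoeff_add_left (h : k + l = n) (u u' : Covector n k 𝔤) (v : Covector n l 𝔤) :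
    wedgeCoeff h (u + u') v = wedgeCoeff h u v + wedgeCoeff h u' v := by
  have hpos : ((k.factorial * l.factorial : ℕ) : ℝ) ≠ 0 := by positivity
  apply mul_left_cancel₀ hpos
  simp only [mul_add, factorial_mul_wedgeCoeff, ← Finset.sum_add_distrib]
  simp [inner_add_left, mul_add]

theorem wedgeCoeff_smul_left (h : k + l = n) (c : ℝ) (u : Covector n k 𝔤) (v : Covector n l 𝔤) :
    wedgeCoeff h (c • u) v = c * wedgeCoeff h u v := by
  have hpos : ((k.factorial * l.factorial : ℕ) : ℝ) ≠ 0 := by positivity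
  apply mul_left_cancel₀ hpos
  rw [mul_left_comm]
  simp only [factorial_mul_wedgeCoeff, Finset.mul_sum]
  refine Finset.sum_congr rfl fun π _ => ?_
  simp [inner_smul_left]
  ring

theorem wedgeCoeff_add_right (h : k + l = n) (u : Covector n k 𝔤) (v v' : Covector n l 𝔤) :
    wedgeCoeff h u (v + v') = wedgeCoeff h u v + wedgeCoeff h u v' := by
  have h' : l + k = n := by omega
  rw [wedgeCoeff_comm h h', wedgeCoeff_add_left, mul_add, ← wedgeCoeff_comm, ← wedgeCoeff_comm]

theorem wedgeCoeff_smul_right (h : k + l = n) (c : ℝ) (u : Covector n k 𝔤) (v : Covector n l 𝔤) :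
    wedgeCoeff h u (c • v) = c * wedgeCoeff h u v := by
  have h' : l + k = n := by omega
  rw [wedgeCoeff_comm h h', wedgeCoeff_smul_left, mul_left_comm, ← wedgeCoeff_comm]

/-- `wedgeCoeff` as a bilinear form. -/
noncomputable def wedgeBilin (h : k + l = n) : Covector n k 𝔤 →ₗ[ℝ] Covector n l 𝔤 →ₗ[ℝ] ℝ :=
  LinearMap.mk₂ ℝ (wedgeCoeff h) (wedgeCoeff_add_left h) (wedgeCoeff_smul_left h)
    (wedgeCoeff_add_right h) (wedgeCoeff_smul_right h)

theorem wedgeCoeff_apply_zero (h : k + l = n) (u : Covector n k 𝔤) :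
    wedgeCoeff h u (0 : Covector n l 𝔤) = 0 :=
  map_zero (wedgeBilin h u)

theorem contDiff_extDeriv {η : Form n k 𝔤} (hη : ContDiff ℝ (⊤ : ℕ∞) η) :
    ContDiff ℝ (⊤ : ℕ∞) (extDeriv η) := by
  have h : ContDiff ℝ (⊤ : ℕ∞) (fderiv ℝ η) := hη.fderiv_right (by simp)
  exact (ContinuousAlternatingMap.alternatizeUncurryFinCLM ℝ (Space n) 𝔤).contDiff.comp h

theorem extDeriv_eq_zero_of_notMem {η : Form n k 𝔤} {x : Space n} (hx : x ∉ tsupport η) :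
    extDeriv η x = 0 := by
  have : fderiv ℝ η x = 0 := by
    by_contra h
    exact hx (support_fderiv_subset ℝ h)
  rw [extDeriv, this]
  exact map_zero (ContinuousAlternatingMap.alternatizeUncurryFinCLM ℝ (Space n) 𝔤)

theorem covector_eq_zero_of_lt (hk : n < k) (u : Covector n k 𝔤) : u = 0 := by
  apply ContinuousAlternatingMap.toAlternatingMap_injective
  refine Module.Basis.ext_alternating (EuclideanSpace.basisFun (Fin n) ℝ).toBasis fun v hv => ?_
  have := Fintype.card_le_of_injective v hv
  simp at this
  omega

variable {U : Set (Space n)}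

theorem setIntegral_wedge_of_tsupport_subset (h : k + l = n) (w : Form n k 𝔤) {η : Form n l 𝔤}
    (hη : tsupport η ⊆ U) :
    ∫ x in U, wedgeCoeff h (w x) (η x) = ∫ x, wedgeCoeff h (w x) (η x) :=
  setIntegral_eq_integral_of_forall_compl_eq_zero fun x hx => by
    rw [image_eq_zero_of_notMem_tsupport fun h => hx (hη h), wedgeCoeff_apply_zero]

theorem setIntegral_wedge_extDeriv_of_tsupport_subset (h : k + (l + 1) = n) (w : Form n k 𝔤)
    {η : Form n l 𝔤} (hη : tsupport η ⊆ U) :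
    ∫ x in U, wedgeCoeff h (w x) (extDeriv η x) = ∫ x, wedgeCoeff h (w x) (extDeriv η x) :=
  setIntegral_eq_integral_of_forall_compl_eq_zero fun x hx => by
    rw [extDeriv_eq_zero_of_notMem fun h => hx (hη h), wedgeCoeff_apply_zero]

/-- The defining property of the weak exterior derivative, with the test form on the left. -/
theorem IsWeakExtDeriv.integral_test_left {D : Form n m 𝔤} {v : Form n (m + 1) 𝔤}
    (hD : IsWeakExtDeriv U D v) (h : k + m + 1 = n) {η : Form n k 𝔤} (hη : ContDiff ℝ (⊤ : ℕ∞) η)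
    (hηc : HasCompactSupport η) (hηU : tsupport η ⊆ U) :
    (∫ x in U, wedgeCoeff (by omega) (extDeriv η x) (D x)) +
      (-1) ^ k * ∫ x in U, wedgeCoeff (by omega) (η x) (v x) = 0 := by
  have h1 := hD.2.2 k (by omega) η hη hηc hηU
  have e1 : ∫ x in U, wedgeCoeff (by omega) (extDeriv η x) (D x) =
      (-1) ^ ((k + 1) * m) * ∫ x in U, wedgeCoeff (by omega) (D x) (extDeriv η x) := by
    rw [← integral_const_mul]
    exact integral_congr_ae (Eventually.of_forall fun x => wedgeCoeff_comm _ _ _ _)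
  have e2 : ∫ x in U, wedgeCoeff (by omega) (η x) (v x) =
      (-1) ^ (k * (m + 1)) * ∫ x in U, wedgeCoeff (by omega) (v x) (η x) := by
    rw [← integral_const_mul]
    exact integral_congr_ae (Eventually.of_forall fun x => wedgeCoeff_comm _ _ _ _)
  rw [e1, e2, h1]
  have hs : ((-1 : ℝ) ^ k) * (-1) ^ k = 1 := by rw [← mul_pow]; simp
  -- The exponents k + k(m + 1) + (m + 1) and (k + 1)m differ by the odd number 2k + 1.
  have e3 : ((-1 : ℝ) ^ k) * ((-1) ^ (k * (m + 1)) * (-1) ^ (m + 1)) = -(-1) ^ ((k + 1) * m) := by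
    rw [mul_add, add_mul, mul_one, one_mul, pow_add, pow_add, pow_succ]
    linear_combination (-(-1 : ℝ) ^ (k * m) * (-1) ^ m) * hs
  rw [← mul_assoc ((-1 : ℝ) ^ (k * (m + 1))), ← mul_assoc ((-1 : ℝ) ^ k), e3]
  ring

/-- Test forms supported in V are test forms on U, and the integrals see only their support. This
restricts derivatives on Ω to the cells. -/
theorem IsWeakExtDeriv.mono {V : Set (Space n)} (hVU : V ⊆ U) {u : Form n k 𝔤}
    {w : Form n (k + 1) 𝔤} (h : IsWeakExtDeriv U u w) : IsWeakExtDeriv V u w := by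
  refine ⟨h.1.mono_set hVU, h.2.1.mono_set hVU, fun m hm η h1 h2 h3 => ?_⟩
  have := h.2.2 m hm η h1 h2 (h3.trans hVU)
  rw [setIntegral_wedge_of_tsupport_subset _ _ (h3.trans hVU),
    setIntegral_wedge_extDeriv_of_tsupport_subset _ _ (h3.trans hVU)] at this
  rw [setIntegral_wedge_of_tsupport_subset _ _ h3,
    setIntegral_wedge_extDeriv_of_tsupport_subset _ _ h3, this]

variable [FiniteDimensional ℝ 𝔤]

/-- `wedgeCoeff` as a continuous bilinear form. -/
noncomputable def wedgeCLM (h : k + l = n) : Covector n k 𝔤 →L[ℝ] Covector n l 𝔤 →L[ℝ] ℝ :=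
  continuousBilin (wedgeBilin h)

variable (𝔤) in
/-- The exterior derivatives on `k`- and on `(n-k-1)`-forms are adjoint to each other. -/
noncomputable def extDerivDuality (h : k + m + 1 = n) : FirstOrderDuality (Space n)
    (Covector n k 𝔤) (Covector n m 𝔤) (Covector n (k + 1) 𝔤) (Covector n (m + 1) 𝔤) where
  symbolLeft := ContinuousAlternatingMap.alternatizeUncurryFinCLM ℝ (Space n) 𝔤
  symbolRight := ContinuousAlternatingMap.alternatizeUncurryFinCLM ℝ (Space n) 𝔤
  pairLeft := wedgeCLM (by omega)
  -- The sign of the Leibniz rule is absorbed here, which makes `pair_symbol` free of signs.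
  pairRight := continuousBilin ((-1 : ℝ) ^ k • wedgeBilin (by omega))
  pair_symbol ℓ x y := wedgeCoeff_covWedge_left (by omega) (by omega) ℓ x y

theorem integral_pairRight_extDerivDuality (h : k + m + 1 = n) (u : Form n k 𝔤)
    (v : Form n (m + 1) 𝔤) (U : Set (Space n)) :
    ∫ x in U, (extDerivDuality 𝔤 h).pairRight (u x) (v x) =
      (-1) ^ k * ∫ x in U, wedgeCoeff (by omega) (u x) (v x) := by
  rw [← integral_const_mul]
  rfl

theorem integrable_wedgeCoeff {p q : ENNReal} [p.HolderConjugate q] {ν : Measure (Space n)}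
    (h : k + l = n) {u : Form n k 𝔤} {v : Form n l 𝔤} (hu : MemLp u p ν) (hv : MemLp v q ν) :
    Integrable (fun x => wedgeCoeff h (u x) (v x)) ν :=
  integrable_bilin_of_memLp (wedgeCLM h) hu hv

/-- Nondegeneracy of the wedge pairing feeds the fundamental lemma; for k ≥ n there are no test
forms, but all (k + 1)-covectors vanish. It follows that boundary integrals do not depend on the
derivative chosen in `weakExtDeriv`. -/
theorem IsWeakExtDeriv.ae_eq (hU : IsOpen U) {u : Form n k 𝔤} {w w' : Form n (k + 1) 𝔤}
    (h : IsWeakExtDeriv U u w) (h' : IsWeakExtDeriv U u w') : w =ᵐ[volume.restrict U] w' := by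
  by_cases hk : n < k + 1
  · exact Eventually.of_forall fun x => by
      rw [covector_eq_zero_of_lt hk (w x), covector_eq_zero_of_lt hk (w' x)]
  · obtain ⟨m, hm⟩ : ∃ m, k + m + 1 = n := ⟨n - k - 1, by omega⟩
    have hm' : k + 1 + m = n := by omega
    refine ae_eq_of_forall_integral_pair_eq (wedgeCLM hm')
      (fun x hx => eq_zero_of_wedgeCoeff_eq_zero hm' x hx) hU h.2.1 h'.2.1 fun η h1 h2 h3 => ?_
    exact (h.2.2 m hm η h1 h2 h3).trans (h'.2.2 m hm η h1 h2 h3).symm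

theorem IsWeakExtDeriv.weakExtDeriv_ae_eq (hU : IsOpen U) {u : Form n k 𝔤}
    {w : Form n (k + 1) 𝔤} (h : IsWeakExtDeriv U u w) :
    weakExtDeriv U u =ᵐ[volume.restrict U] w := by
  have hex : ∃ w, IsWeakExtDeriv U u w := ⟨w, h⟩
  rw [weakExtDeriv, dif_pos hex]
  exact hex.choose_spec.ae_eq hU h

/-- The exterior derivative of a smooth form is its weak exterior derivative. -/
theorem isWeakExtDeriv_extDeriv (U : Set (Space n)) {u : Form n k 𝔤}
    (hu : ContDiff ℝ (⊤ : ℕ∞) u) : IsWeakExtDeriv U u (extDeriv u) := by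
  refine ⟨hu.continuous.locallyIntegrable.locallyIntegrableOn U,
    (contDiff_extDeriv hu).continuous.locallyIntegrable.locallyIntegrableOn U,
    fun m hm η h1 h2 h3 => ?_⟩
  rw [setIntegral_wedge_of_tsupport_subset _ _ h3,
    setIntegral_wedge_extDeriv_of_tsupport_subset _ _ h3]
  have key := (extDerivDuality 𝔤 hm).integral_smooth (μ := volume) hu h1 (Or.inr h2)
  have h4 := integral_pairRight_extDerivDuality hm u (extDeriv η) univ
  simp only [Measure.restrict_univ] at h4
  have h5 : (∫ x, wedgeCoeff (by omega) (extDeriv u x) (η x)) +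
      (-1) ^ k * ∫ x, wedgeCoeff (by omega) (u x) (extDeriv η x) = 0 := by
    rw [← h4]
    exact key
  rw [pow_succ]
  linarith

end Forms
end YangMills

namespace YangMills

/-! ### Summation over cells and the equivalence. -/

section Assembly

open Set Filter Topology

variable {n k m : ℕ} {𝔤 : Type*} [NormedAddCommGroup 𝔤] [InnerProductSpace ℝ 𝔤]
  {p q p' q' : ENNReal} {Ω : Set (Space n)}

theorem locallyIntegrableOn_of_memLp {F : Type*} [NormedAddCommGroup F]
    (hΩ : Bornology.IsBounded Ω) (hp : 1 ≤ p) {f : Space n → F}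
    (hf : MemLp f p (volume.restrict Ω)) : LocallyIntegrableOn f Ω volume := by
  have : IsFiniteMeasure (volume.restrict Ω) := ⟨by simpa using hΩ.measure_lt_top⟩
  have : IntegrableOn f Ω volume := hf.integrable hp
  exact this.locallyIntegrableOn

theorem memLp_of_continuous {F : Type*} [NormedAddCommGroup F]
    (hΩ : Bornology.IsBounded Ω) {f : Space n → F}
    (hf : Continuous f) : MemLp f p (volume.restrict Ω) := by
  have : IsFiniteMeasure (volume.restrict (closure Ω)) :=
    ⟨by simpa using hΩ.isCompact_closure.measure_lt_top⟩
  obtain ⟨C, hC⟩ := hΩ.isCompact_closure.exists_bound_of_continuousOn hf.continuousOn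
  have h : MemLp f p (volume.restrict (closure Ω)) :=
    (memLp_top_of_bound hf.aestronglyMeasurable C
      (ae_restrict_of_forall_mem isClosed_closure.measurableSet hC)).mono_exponent le_top
  exact h.mono_measure (Measure.restrict_mono subset_closure le_rfl)

theorem memLp_sum_indicator {α ι F : Type*} [MeasurableSpace α] {ν : Measure α}
    [NormedAddCommGroup F] (t : Finset ι) {U : ι → Set α} {f : ι → α → F}
    (hU : ∀ i ∈ t, MeasurableSet (U i)) (hf : ∀ i ∈ t, MemLp (f i) q (ν.restrict (U i))) :
    MemLp (fun x => ∑ i ∈ t, (U i).indicator (f i) x) q ν :=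
  memLp_finsetSum t fun i hi => (memLp_indicator_iff_restrict (hU i hi)).2 (hf i hi)

/-- Cellwise weak exterior derivatives can be glued to a single form. -/
theorem Triangulation.exists_broken_weakExtDeriv (T : Triangulation Ω)
    {u : Form n k 𝔤} (hu : ∀ s ∈ T.cells, ∃ w, IsWeakExtDeriv (cellInterior s) u w ∧
      MemLp w q (volume.restrict (cellInterior s))) :
    ∃ w, (∀ s ∈ T.cells, IsWeakExtDeriv (cellInterior s) u w) ∧
      MemLp w q (volume.restrict Ω) := by
  choose! W hW hWq using hu
  let w : Form n (k + 1) 𝔤 := fun x => ∑ s ∈ T.cells, (cellInterior s).indicator (W s) x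
  have hw : ∀ s ∈ T.cells, EqOn w (W s) (cellInterior s) := by
    intro s hs x hx
    refine (Finset.sum_eq_single_of_mem s hs fun t ht hts => ?_).trans (indicator_of_mem hx _)
    refine indicator_of_notMem (fun hxt => ?_) _
    exact (T.pairwiseDisjoint_cellInterior hs ht hts.symm).le_bot ⟨hx, hxt⟩
  have hae : ∀ s ∈ T.cells, w =ᵐ[volume.restrict (cellInterior s)] W s := fun s hs =>
    (ae_restrict_mem (isOpen_cellInterior s).measurableSet).mono fun x hx => hw s hs hx
  refine ⟨w, fun s hs => ⟨(hW s hs).1, ?_, fun m hm η h1 h2 h3 => ?_⟩, ?_⟩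
  · refine (locallyIntegrableOn_iff (isOpen_cellInterior s).isLocallyClosed).2 fun K hK hKc => ?_
    have := (locallyIntegrableOn_iff (isOpen_cellInterior s).isLocallyClosed).1 (hW s hs).2.1 K hK
      hKc
    exact this.congr_fun (fun x hx => (hw s hs (hK hx)).symm) hKc.measurableSet
  · rw [← (hW s hs).2.2 m hm η h1 h2 h3]
    refine integral_congr_ae ?_
    filter_upwards [hae s hs] with x hx
    rw [hx]
  · exact (memLp_sum_indicator T.cells (fun s _ => (isOpen_cellInterior s).measurableSet)
      hWq).restrict Ω

variable [FiniteDimensional ℝ 𝔤]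

/-- The boundary integral in terms of any choice of weak exterior derivatives. -/
theorem boundaryIntegral_eq_setIntegral (h : k + m + 1 = n) {U : Set (Space n)} (hU : IsOpen U)
    {u : Form n k 𝔤} {w : Form n (k + 1) 𝔤} {D : Form n m 𝔤} {v : Form n (m + 1) 𝔤}
    (hu : IsWeakExtDeriv U u w) (hD : IsWeakExtDeriv U D v) :
    boundaryIntegral h U u D = ∫ x in U, (wedgeCoeff (by omega) (w x) (D x) +
      (-1) ^ k * wedgeCoeff (by omega) (u x) (v x)) := by
  refine integral_congr_ae ?_
  filter_upwards [hu.weakExtDeriv_ae_eq hU, hD.weakExtDeriv_ae_eq hU] with x h1 h2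
  rw [h1, h2]

theorem integral_wedge_add [p.HolderConjugate p'] [q.HolderConjugate q'] {ν : Measure (Space n)}
    (h : k + m + 1 = n) {u : Form n k 𝔤} {w : Form n (k + 1) 𝔤} {D : Form n m 𝔤}
    {v : Form n (m + 1) 𝔤} (hu : MemLp u p ν) (hw : MemLp w q ν) (hD : MemLp D q' ν)
    (hv : MemLp v p' ν) :
    ∫ x, (wedgeCoeff (by omega) (w x) (D x) + (-1) ^ k * wedgeCoeff (by omega) (u x) (v x)) ∂ν =
      (∫ x, wedgeCoeff (by omega) (w x) (D x) ∂ν) +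
        (-1) ^ k * ∫ x, wedgeCoeff (by omega) (u x) (v x) ∂ν := by
  rw [← integral_const_mul]
  exact integral_add (integrable_wedgeCoeff _ hw hD) ((integrable_wedgeCoeff _ hu hv).const_mul _)

theorem integrable_wedge_add [p.HolderConjugate p'] [q.HolderConjugate q'] {ν : Measure (Space n)}
    (h : k + m + 1 = n) {u : Form n k 𝔤} {w : Form n (k + 1) 𝔤} {D : Form n m 𝔤}
    {v : Form n (m + 1) 𝔤} (hu : MemLp u p ν) (hw : MemLp w q ν) (hD : MemLp D q' ν)
    (hv : MemLp v p' ν) :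
    Integrable (fun x => wedgeCoeff (by omega) (w x) (D x) +
      (-1) ^ k * wedgeCoeff (by omega) (u x) (v x)) ν :=
  (integrable_wedgeCoeff _ hw hD).add ((integrable_wedgeCoeff _ hu hv).const_mul _)

/-- For a broken form, the element boundary terms add up to an integral over the domain. -/
theorem sum_boundaryIntegral_eq [p.HolderConjugate p'] [q.HolderConjugate q']
    (hΩ : IsLipschitzDomain Ω) (T : Triangulation Ω) (h : k + m + 1 = n) {u : Form n k 𝔤}
    {w : Form n (k + 1) 𝔤} {D : Form n m 𝔤} {v : Form n (m + 1) 𝔤}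
    (huw : ∀ s ∈ T.cells, IsWeakExtDeriv (cellInterior s) u w) (hDv : IsWeakExtDeriv Ω D v)
    (hu : MemLp u p (volume.restrict Ω)) (hw : MemLp w q (volume.restrict Ω))
    (hD : MemLp D q' (volume.restrict Ω)) (hv : MemLp v p' (volume.restrict Ω)) :
    ∑ s ∈ T.cells, boundaryIntegral h (cellInterior s) u D =
      ∫ x in Ω, (wedgeCoeff (by omega) (w x) (D x) +
        (-1) ^ k * wedgeCoeff (by omega) (u x) (v x)) := by
  have hint : IntegrableOn (fun x => wedgeCoeff (by omega) (w x) (D x) +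
      (-1) ^ k * wedgeCoeff (by omega) (u x) (v x)) Ω := integrable_wedge_add h hu hw hD hv
  -- Faces carry no mass, so the integral over Ω splits over cell interiors, to which the weak
  -- derivative of `D` restricts.
  rw [← setIntegral_congr_set (T.ae_eq_biUnion_cellInterior hΩ),
    integral_biUnion_finset _ (fun s _ => (isOpen_cellInterior s).measurableSet)
      T.pairwiseDisjoint_cellInterior
      fun s hs => hint.mono_set (T.cellInterior_subset hΩ hs)]
  exact Finset.sum_congr rfl fun s hs => boundaryIntegral_eq_setIntegral h (isOpen_cellInterior s)
    (huw s hs) (hDv.mono (T.cellInterior_subset hΩ hs))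

/-- A weakly differentiable form has vanishing tangential trace if and only if Green's formula
without boundary term holds for all smooth test forms. -/
theorem hasZeroTangentialTrace_iff (hΩ : IsLipschitzDomain Ω) {u : Form n k 𝔤}
    {w : Form n (k + 1) 𝔤} (huw : IsWeakExtDeriv Ω u w) :
    HasZeroTangentialTrace Ω u ↔
      ∀ (m : ℕ) (h : k + m + 1 = n) (η : Form n m 𝔤), ContDiff ℝ (⊤ : ℕ∞) η →
        ∫ x in Ω, (wedgeCoeff (by omega) (w x) (η x) +
          (-1) ^ k * wedgeCoeff (by omega) (u x) (extDeriv η x)) = 0 := by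
  refine forall₂_congr fun m h => forall₂_congr fun η hη => ?_
  rw [boundaryIntegral_eq_setIntegral h hΩ.isOpen huw (isWeakExtDeriv_extDeriv Ω hη)]

/-- Green's formula: a form with vanishing tangential trace satisfies integration by parts against
all forms of dual regularity. -/
theorem integral_eq_zero_of_hasZeroTangentialTrace [p.HolderConjugate p'] [q.HolderConjugate q']
    (hΩ : IsLipschitzDomain Ω) (hp' : p' ≠ ⊤) (hq' : q' ≠ ⊤) (hqp : q ≤ p)
    (h : k + m + 1 = n) {u : Form n k 𝔤} {w : Form n (k + 1) 𝔤} {D : Form n m 𝔤}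
    {v : Form n (m + 1) 𝔤} (huw : IsWeakExtDeriv Ω u w) (h0 : HasZeroTangentialTrace Ω u)
    (hDv : IsWeakExtDeriv Ω D v) (hu : MemLp u p (volume.restrict Ω))
    (hw : MemLp w q (volume.restrict Ω)) (hD : MemLp D q' (volume.restrict Ω))
    (hv : MemLp v p' (volume.restrict Ω)) :
    ∫ x in Ω, (wedgeCoeff (by omega) (w x) (D x) +
      (-1) ^ k * wedgeCoeff (by omega) (u x) (v x)) = 0 := by
  have key := (extDerivDuality 𝔤 h).integral_eq_zero (μ := volume) hp' hq' hqp hΩ.isOpen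
    hΩ.isBounded (fun x hx => hΩ.exists_cone hx) hu hw hD hv (fun η hη => ?_)
    (fun η hη hηc hηΩ => ?_)
  · rw [integral_wedge_add h hu hw hD hv, ← integral_pairRight_extDerivDuality h]
    exact key
  · have h1 := (hasZeroTangentialTrace_iff hΩ huw).1 h0 m h η hη
    rw [integral_wedge_add (p' := p') (q' := q') h hu hw
        (memLp_of_continuous hΩ.isBounded hη.continuous)
      (memLp_of_continuous hΩ.isBounded (contDiff_extDeriv hη).continuous),
      ← integral_pairRight_extDerivDuality h] at h1
    exact h1
  · have h1 := hDv.integral_test_left h hη hηc hηΩ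
    rw [← integral_pairRight_extDerivDuality h] at h1
    exact h1

/-- A broken form is weakly differentiable on the whole domain, with vanishing tangential trace, if
and only if its element boundary terms cancel against all single-valued multipliers of dual
regularity. -/
theorem mem_WSpace_and_hasZeroTangentialTrace_iff [p.HolderConjugate p'] [q.HolderConjugate q']
    (hΩ : IsLipschitzDomain Ω) (T : Triangulation Ω)
    (hp' : p' ≠ ⊤) (hq' : q' ≠ ⊤) (hqp : q ≤ p) {u : Form n k 𝔤}
    (hu : MemLp u p (volume.restrict Ω))
    (hcell : ∀ s ∈ T.cells, ∃ w, IsWeakExtDeriv (cellInterior s) u w ∧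
      MemLp w q (volume.restrict (cellInterior s))) :
    (u ∈ WSpace n k 𝔤 Ω p q ∧ HasZeroTangentialTrace Ω u) ↔
      ∀ (m : ℕ) (h : k + m + 1 = n), ∀ D ∈ WSpace n m 𝔤 Ω q' p',
        ∑ s ∈ T.cells, boundaryIntegral h (cellInterior s) u D = 0 := by
  constructor
  · rintro ⟨⟨-, w, huw, hw⟩, h0⟩ m h D ⟨hD, v, hDv, hv⟩
    rw [sum_boundaryIntegral_eq hΩ T h (fun s hs => huw.mono (T.cellInterior_subset hΩ hs)) hDv hu
      hw hD hv]
    exact integral_eq_zero_of_hasZeroTangentialTrace hΩ hp' hq' hqp h huw h0 hDv hu hw hD hv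
  · intro H
    obtain ⟨w, hcw, hw⟩ := T.exists_broken_weakExtDeriv hcell
    -- Forms smooth up to the boundary are admissible multipliers; nothing more of `H` is used.
    have hsmooth : ∀ (m : ℕ) (h : k + m + 1 = n) (η : Form n m 𝔤), ContDiff ℝ (⊤ : ℕ∞) η →
        ∫ x in Ω, (wedgeCoeff (by omega) (w x) (η x) +
          (-1) ^ k * wedgeCoeff (by omega) (u x) (extDeriv η x)) = 0 := fun m h η hη => by
      have h1 : MemLp η q' (volume.restrict Ω) :=
        memLp_of_continuous hΩ.isBounded hη.continuous
      have h2 : MemLp (extDeriv η) p' (volume.restrict Ω) :=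
        memLp_of_continuous hΩ.isBounded (contDiff_extDeriv hη).continuous
      have h3 := isWeakExtDeriv_extDeriv Ω hη
      rw [← sum_boundaryIntegral_eq hΩ T h hcw h3 hu hw h1 h2]
      exact H m h η ⟨h1, _, h3, h2⟩
    -- Compactly supported multipliers rule out jumps across faces: the glued `w` is a derivative on
    -- all of Ω.
    have huw : IsWeakExtDeriv Ω u w := by
      refine ⟨locallyIntegrableOn_of_memLp hΩ.isBounded (ENNReal.HolderConjugate.one_le p p') hu,
        locallyIntegrableOn_of_memLp hΩ.isBounded (ENNReal.HolderConjugate.one_le q q') hw,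
        fun m h η hη hηc hηΩ => ?_⟩
      have h1 := hsmooth m h η hη
      rw [integral_wedge_add (p' := p') (q' := q') h hu hw
        (memLp_of_continuous hΩ.isBounded hη.continuous)
        (memLp_of_continuous hΩ.isBounded (contDiff_extDeriv hη).continuous)] at h1
      rw [pow_succ]
      linarith
    exact ⟨⟨hu, w, huw, hw⟩, (hasZeroTangentialTrace_iff hΩ huw).2 hsmooth⟩

theorem holderConjugate_four : ENNReal.HolderConjugate 4 (4 / 3) := by
  rw [ENNReal.holderConjugate_iff, ENNReal.inv_div (by simp) (by simp)]
  rw [← one_div, ← ENNReal.add_div]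
  norm_num
  exact ENNReal.div_self (by simp) (by simp)

end Assembly
end YangMills

theorem mainTheorem4 {n : ℕ} {𝔤 : Type*} [NormedAddCommGroup 𝔤] [InnerProductSpace ℝ 𝔤]
    [FiniteDimensional ℝ 𝔤] (Ω : Set (YangMills.Space n)) (hΩ : YangMills.IsLipschitzDomain Ω)
    (T : YangMills.Triangulation Ω) :
    (∀ φ ∈ YangMills.DV0 𝔤 T,
      (φ ∈ YangMills.V0Ring 𝔤 Ω ↔
        ∀ (m : ℕ) (h : 0 + m + 1 = n), ∀ D ∈ YangMills.VHatD 𝔤 Ω m,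
          ∑ s ∈ T.cells, YangMills.boundaryIntegral h (YangMills.cellInterior s) φ D = 0)) ∧
    (∀ A ∈ YangMills.DV1 𝔤 T,
      (A ∈ YangMills.V1Ring 𝔤 Ω ↔
        ∀ (m : ℕ) (h : 1 + m + 1 = n), ∀ H ∈ YangMills.VHatH 𝔤 Ω m,
          ∑ s ∈ T.cells, YangMills.boundaryIntegral h (YangMills.cellInterior s) A H = 0)) := by
  have h4 := YangMills.holderConjugate_four
  have h43 : (4 / 3 : ENNReal) ≠ ⊤ := ENNReal.div_ne_top (by simp) (by simp)
  refine ⟨fun φ hφ => ?_, fun A hA => ?_⟩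
  -- The multiplier has exponent q' and its derivative p'. Here p = ∞ is allowed because only p' = 1
  -- and q' = 4/3 must be finite; in the second part q = 2 is self-dual.
  · exact YangMills.mem_WSpace_and_hasZeroTangentialTrace_iff (p := ⊤) (q := 4) (p' := 1)
      (q' := 4 / 3) hΩ T (by simp) h43 le_top hφ.1 hφ.2
  · exact YangMills.mem_WSpace_and_hasZeroTangentialTrace_iff (p := 4) (q := 2) (p' := 4 / 3)
      (q' := 2) hΩ T h43 (by simp) (by norm_num) hA.1 hA.2
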